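/- Let $N\ge 0$ be an integer. Let $UC_N(\mathbb{C})$ be the space of configurations of $N$ distinct unordered points of $\mathbb{C}$ (the quotient of $\{E\in\mathbb{C}^N: E_i\ne E_j \text{ for } i\neq j\}$ by the symmetric group), and let $B_N=\pi_1(UC_N(\mathbb{C}),\{0,1,\dots,N-1\})$ be the braid group on $N$ strands. For $0\le i\le N-2$ let $b_i\in B_N$ be the standard generator: the class of the loop in which the points $i$ and $i+1$ exchange places by a counterclockwise half turn about their midpoint, while the other points are at rest. Let $\mathcal{H}$ be an $N$-level Hamiltonian, that is, a map from a topological space of parameters to the complex $N\times N$ matrices, and let $\Gamma$ be a loop in the parameter space along which $\mathcal{H}$ is continuous and has separable bands: at every point of $\Gamma$ the $N$ eigenvalues of $\mathcal{H}$ are pairwise distinct. Let $\Delta$ be the discriminant of the characteristic polynomial of $\mathcal{H}$, and let $$\mathcal{D}(\Gamma)=\frac1{2\pi}\oint_\Gamma d\arg\Delta$$ be the discriminant number, where $\oint_\Gamma d\arg\Delta$ is the total increment along $\Gamma$ of a continuous argument of $\Delta$. The eigenvalues of $\mathcal{H}$ along $\Gamma$ form a loop in $UC_N(\mathbb{C})$.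 Let $b(\Gamma)\in B_N$ be the braid obtained from its class by transport to the base configuration along any chosen path in $UC_N(\mathbb{C})$ from the base configuration to the eigenvalue configuration at the base point of $\Gamma$. Theorem. 1. The braid $b(\Gamma)$ can be written as a word $b(\Gamma)=b_{i_1}^{n_1}b_{i_2}^{n_2}\cdots b_{i_L}^{n_L}$ with $n_1,\dots,n_L\in\mathbb{Z}$, and for every such word $$\mathcal{D}(\Gamma)=\sum_{l=1}^{L}n_l .$$ In particular $\mathcal{D}(\Gamma)$ is an integer. 2. Every element of $B_N$ is the eigenvalue braid $b(\Gamma)$ of some such $\mathcal{H}$ and $\Gamma$ (with some choice of the connecting path), and $b(\Gamma)\mapsto\mathcal{D}(\Gamma)$ is a well-defined group homomorphism $F:B_N\to\mathbb{Z}$ whose kernel is the commutator subgroup of $B_N$. If $N\ge 2$, then $F$ is surjective, so that $F$ is the abelianization of $B_N$. -/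

import Mathlib

open scoped unitInterval

universe u

/-! ### Configurations of `N` distinct points of the complex plane and the braid group -/

/-- Ordered configurations of `N` pairwise distinct complex numbers. -/
abbrev OrdConf (N : ℕ) : Type := {E : Fin N → ℂ // Function.Injective E}

/-- Two ordered configurations are identified if they differ by a relabelling of the points. -/
instance ordConfSetoid (N : ℕ) : Setoid (OrdConf N) where
  r E E' := ∃ s : Equiv.Perm (Fin N), ∀ j, E'.1 j = E.1 (s j)
  iseqv :=
    { refl := fun _ => ⟨1, fun _ => rfl⟩
      symm := fun ⟨s, h⟩ => ⟨s⁻¹, fun j => by simp [h]⟩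
      trans := fun ⟨s, h⟩ ⟨s', h'⟩ => ⟨s * s', fun j => by simp [h, h']⟩ }

/-- The configuration space of `N` distinct unlabelled points of the complex plane, with the
quotient topology. -/
abbrev UConf (N : ℕ) : Type := Quotient (ordConfSetoid N)

/-- The base configuration `{0, 1, …, N - 1}`, labelled by increasing real part. -/
def baseTuple (N : ℕ) : OrdConf N :=
  ⟨fun j => ((j : ℕ) : ℂ), fun _ _ h => Fin.ext (Nat.cast_injective h)⟩

/-- The base configuration `{0, 1, …, N - 1}`. -/
def baseConf (N : ℕ) : UConf N := ⟦baseTuple N⟧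

/-- Every configuration can be joined to the base configuration: label its points by increasing
real part and move along straight lines. -/
theorem joined_baseConf {N : ℕ} (c : UConf N) : Joined (baseConf N) c := by
  induction c using Quotient.inductionOn with
  | h E =>
    set s := Tuple.sort fun j => (E.1 j).re with hs
    have hm : Monotone fun j => (E.1 (s j)).re := Tuple.monotone_sort fun j => (E.1 j).re
    have hlt : ∀ (t : I) (i j : Fin N), i < j →
        (1 - (t : ℝ) : ℂ) * (i : ℕ) + (t : ℝ) * E.1 (s i) ≠
          (1 - (t : ℝ) : ℂ) * (j : ℕ) + (t : ℝ) * E.1 (s j) := by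
      intro t i j hij h
      rcases eq_or_lt_of_le t.2.2 with h1 | h1
      · rw [h1] at h
        simp only [Complex.ofReal_one, sub_self, zero_mul, zero_add, one_mul] at h
        exact hij.ne (s.injective (E.2 h))
      · have h2 := congrArg Complex.re h
        simp only [← Complex.ofReal_one, ← Complex.ofReal_sub, Complex.add_re, Complex.re_ofReal_mul,
          Complex.natCast_re] at h2
        have h3 : (E.1 (s i)).re ≤ (E.1 (s j)).re := hm hij.le
        have h4 : ((i : ℕ) : ℝ) < (j : ℕ) := by exact_mod_cast hij
        have h5 := t.2.1
        nlinarith [mul_le_mul_of_nonneg_left h3 h5, mul_lt_mul_of_pos_left h4 (sub_pos.2 h1)]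
    have hinj : ∀ t : I, Function.Injective fun j : Fin N =>
        (1 - (t : ℝ) : ℂ) * (j : ℕ) + (t : ℝ) * E.1 (s j) := by
      intro t i j h
      rcases lt_trichotomy i j with hij | hij | hij
      · exact absurd h (hlt t i j hij)
      · exact hij
      · exact absurd h.symm (hlt t j i hij)
    refine ⟨⟨⟨fun t => Quotient.mk (ordConfSetoid N) ⟨_, hinj t⟩, ?_⟩, ?_, ?_⟩⟩
    · refine continuous_quotient_mk'.comp (Continuous.subtype_mk ?_ _)
      fun_prop
    · refine congrArg _ (Subtype.ext (funext fun j => ?_))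
      simp [baseTuple]
    · refine Quotient.sound (s := ordConfSetoid N) ?_
      show ∃ s' : Equiv.Perm (Fin N), ∀ j : Fin N, E.1 j =
        (1 - ((1 : I) : ℝ) : ℂ) * ((s' j : Fin N) : ℕ) + ((1 : I) : ℝ) * E.1 (s (s' j))
      exact ⟨s⁻¹, fun j => by simp⟩

/-- The braid group on `N` strands: the fundamental group of the space of configurations of `N`
distinct unlabelled points of the plane. -/
abbrev BraidGroup (N : ℕ) : Type := FundamentalGroup (UConf N) (baseConf N)

/-- The motion of the `N` points in which the two neighbouring points `i` and `i + 1` turn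
counterclockwise around their midpoint by the angle `π t`, and the other points are at rest. -/
noncomputable def halfTwistFun {N : ℕ} (i : Fin (N - 1)) (t : ℝ) (j : Fin N) : ℂ :=
  if (j : ℕ) = i then ((i : ℕ) : ℂ) + 1 / 2 - Complex.exp (Real.pi * t * Complex.I) / 2
  else if (j : ℕ) = i + 1 then ((i : ℕ) : ℂ) + 1 / 2 + Complex.exp (Real.pi * t * Complex.I) / 2
  else ((j : ℕ) : ℂ)

theorem halfTwist_norm (t : ℝ) : ‖Complex.exp (Real.pi * t * Complex.I)‖ = 1 := by
  have := Complex.norm_exp_ofReal_mul_I (Real.pi * t)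
  push_cast at this
  exact this

theorem halfTwist_ne (i k : ℕ) (h : k ≠ i) (h' : k ≠ i + 1) (z : ℂ) (hz : ‖z‖ = 1) :
    (k : ℂ) ≠ (i : ℂ) + 1 / 2 + z / 2 := by
  intro e
  have e1 : z = (((2 * (k : ℤ) - 2 * i - 1 : ℤ) : ℝ) : ℂ) := by
    push_cast
    linear_combination (-2 : ℂ) * e
  rw [e1, Complex.norm_real, Real.norm_eq_abs] at hz
  have h3 : |(2 * (k : ℤ) - 2 * i - 1 : ℤ)| = 1 := by exact_mod_cast hz
  rcases (abs_eq (by norm_num)).1 h3 with h4 | h4 <;> omega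

theorem halfTwistFun_injective {N : ℕ} (i : Fin (N - 1)) (t : ℝ) :
    Function.Injective (halfTwistFun (N := N) i t) := by
  set z := Complex.exp (Real.pi * t * Complex.I) with hz
  have n1 : ‖z‖ = 1 := halfTwist_norm t
  have n2 : ‖-z‖ = 1 := by rw [norm_neg, n1]
  have z0 : z ≠ 0 := Complex.exp_ne_zero _
  have a1 : ∀ k : ℕ, k ≠ i → k ≠ i + 1 → (k : ℂ) ≠ ((i : ℕ) : ℂ) + 1 / 2 + z / 2 :=
    fun k h h' => halfTwist_ne i k h h' z n1
  have a2 : ∀ k : ℕ, k ≠ i → k ≠ i + 1 → (k : ℂ) ≠ ((i : ℕ) : ℂ) + 1 / 2 - z / 2 := by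
    intro k h h' e
    exact halfTwist_ne i k h h' (-z) n2 (by rw [e]; ring)
  have a3 : ((i : ℕ) : ℂ) + 1 / 2 + z / 2 ≠ ((i : ℕ) : ℂ) + 1 / 2 - z / 2 := by
    intro e
    exact z0 (by linear_combination e)
  intro j k h
  simp only [halfTwistFun, ← hz] at h
  apply Fin.ext
  split_ifs at h with h1 h2 h3 h4 h5 h6 h7 h8
  all_goals first
    | omega
    | exact absurd h a3
    | exact absurd h.symm a3
    | exact absurd h (a1 _ ‹_› ‹_›)
    | exact absurd h.symm (a1 _ ‹_› ‹_›)
    | exact absurd h (a2 _ ‹_› ‹_›)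
    | exact absurd h.symm (a2 _ ‹_› ‹_›)
    | exact_mod_cast h

/-- The positive half twist of the points `i` and `i + 1`, as a loop of configurations. -/
noncomputable def halfTwist {N : ℕ} (i : Fin (N - 1)) : Path (baseConf N) (baseConf N) where
  toFun t := ⟦⟨halfTwistFun i t, halfTwistFun_injective i t⟩⟧
  continuous_toFun := by
    refine continuous_quotient_mk'.comp (Continuous.subtype_mk ?_ _)
    refine continuous_pi fun j => ?_
    unfold halfTwistFun
    split_ifs <;> fun_prop
  source' := by
    refine congrArg _ (Subtype.ext (funext fun j => ?_))
    simp only [halfTwistFun, baseTuple, Set.Icc.coe_zero, Complex.ofReal_zero, mul_zero, zero_mul,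
      Complex.exp_zero]
    split_ifs with h1 h2
    · rw [h1]; ring
    · rw [h2]; push_cast; ring
    · rfl
  target' := by
    have hi := i.2
    refine Quotient.sound (s := ordConfSetoid N) ?_
    show ∃ s : Equiv.Perm (Fin N), ∀ j : Fin N, ((j : ℕ) : ℂ) = halfTwistFun i ((1 : I) : ℝ) (s j)
    refine ⟨Equiv.swap ⟨i, by omega⟩ ⟨i + 1, by omega⟩, fun j => ?_⟩
    simp only [halfTwistFun, Set.Icc.coe_one, Complex.ofReal_one, mul_one,
      Complex.exp_pi_mul_I, Equiv.swap_apply_def, Fin.ext_iff]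
    by_cases h1 : (j : ℕ) = i
    · simp [h1]; ring
    · by_cases h2 : (j : ℕ) = i + 1
      · simp [h2]; ring
      · simp [h1, h2]

/-- The standard generator of the braid group that exchanges the strands `i` and `i + 1` by a
positive half twist. -/
noncomputable def braidGen {N : ℕ} (i : Fin (N - 1)) : BraidGroup N :=
  FundamentalGroup.fromPath (Path.Homotopic.Quotient.mk (halfTwist i))

/-- The braid `b_{i₁}^{n₁} ⋯ b_{i_L}^{n_L}` spelled by the word `[(i₁, n₁), …, (i_L, n_L)]`. -/
noncomputable def braidOfWord {N : ℕ} (w : List (Fin (N - 1) × ℤ)) : BraidGroup N :=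
  (w.map fun p => braidGen p.1 ^ p.2).prod

/-- The exponent sum `n₁ + ⋯ + n_L` of the word `[(i₁, n₁), …, (i_L, n_L)]`. -/
def exponentSum {N : ℕ} (w : List (Fin (N - 1) × ℤ)) : ℤ := (w.map Prod.snd).sum

/-! ### The eigenvalue configuration of a matrix and its continuity -/

theorem exists_eigenvalueTuple {N : ℕ} (A : Matrix (Fin N) (Fin N) ℂ) :
    ∃ E : Fin N → ℂ, Finset.univ.val.map E = A.charpoly.roots := by
  have hc : A.charpoly.roots.card = N := by
    rw [← (IsAlgClosed.splits A.charpoly).natDegree_eq_card_roots,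
      Matrix.charpoly_natDegree_eq_dim, Fintype.card_fin]
  obtain ⟨l, hl⟩ := Quot.exists_rep A.charpoly.roots
  have hl' : (l : Multiset ℂ) = A.charpoly.roots := hl
  have hN : l.length = N := by rw [← hc, ← hl', Multiset.coe_card]
  subst hN
  refine ⟨l.get, ?_⟩
  rw [← hl', Fin.univ_val_map, List.ofFn_get]

/-- The eigenvalues of `A`, repeated by algebraic multiplicity, in some order. -/
noncomputable def eigenvalueTuple {N : ℕ} (A : Matrix (Fin N) (Fin N) ℂ) : Fin N → ℂ :=
  (exists_eigenvalueTuple A).choose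

theorem eigenvalueTuple_spec {N : ℕ} (A : Matrix (Fin N) (Fin N) ℂ) :
    Finset.univ.val.map (eigenvalueTuple A) = A.charpoly.roots :=
  (exists_eigenvalueTuple A).choose_spec

theorem injective_of_map_roots {N : ℕ} {A : Matrix (Fin N) (Fin N) ℂ} {E : Fin N → ℂ}
    (hE : Finset.univ.val.map E = A.charpoly.roots) (h : A.charpoly.roots.Nodup) :
    Function.Injective E := by
  rw [← hE] at h
  intro i j hij
  exact Multiset.inj_on_of_nodup_map h i (Finset.mem_univ i) j (Finset.mem_univ j) hij

/-- The configuration of the `N` distinct eigenvalues of a matrix with simple spectrum. -/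
noncomputable def eigenvalueConf {N : ℕ} (A : Matrix (Fin N) (Fin N) ℂ)
    (h : A.charpoly.roots.Nodup) : UConf N :=
  ⟦⟨eigenvalueTuple A, injective_of_map_roots (eigenvalueTuple_spec A) h⟩⟧

theorem eigenvalueConf_eq_mk {N : ℕ} {A : Matrix (Fin N) (Fin N) ℂ}
    (h : A.charpoly.roots.Nodup) (E : OrdConf N)
    (hE : Finset.univ.val.map E.1 = A.charpoly.roots) : eigenvalueConf A h = ⟦E⟧ := by
  have h1 : ∀ j, ∃ k, eigenvalueTuple A k = E.1 j := by
    intro j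
    have : E.1 j ∈ Finset.univ.val.map (eigenvalueTuple A) := by
      rw [eigenvalueTuple_spec, ← hE]
      exact Multiset.mem_map_of_mem _ (Finset.mem_univ j)
    obtain ⟨k, -, hk⟩ := Multiset.mem_map.1 this
    exact ⟨k, hk⟩
  choose s hs using h1
  have hi : Function.Injective s := fun i j hij => E.2 (by rw [← hs, ← hs, hij])
  exact Quotient.sound
    ⟨Equiv.ofBijective s (Finite.injective_iff_bijective.1 hi), fun j => (hs j).symm⟩

theorem eigenvalueConf_congr {N : ℕ} {A B : Matrix (Fin N) (Fin N) ℂ} (hAB : A = B)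
    (hA : A.charpoly.roots.Nodup) (hB : B.charpoly.roots.Nodup) :
    eigenvalueConf A hA = eigenvalueConf B hB := by
  subst hAB
  rfl

/-- The coefficients of the characteristic polynomial. -/
noncomputable def charCoeffs {N : ℕ} (A : Matrix (Fin N) (Fin N) ℂ) (k : Fin N) : ℂ :=
  A.charpoly.coeff k

theorem continuous_charpoly_coeff {N : ℕ} (k : ℕ) :
    Continuous fun A : Matrix (Fin N) (Fin N) ℂ => A.charpoly.coeff k := by
  have h : ∀ A : Matrix (Fin N) (Fin N) ℂ, A.charpoly.coeff k =
      MvPolynomial.eval (fun p : Fin N × Fin N => A p.1 p.2)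
        ((Matrix.charpoly.univ ℂ (Fin N)).coeff k) := by
    intro A
    have := Matrix.charpoly.univ_map_eval₂Hom (n := Fin N) (RingHom.id ℂ)
      (fun p : Fin N × Fin N => A p.1 p.2)
    have e : Matrix.of (fun i j => (fun p : Fin N × Fin N => A p.1 p.2) (i, j)) = A := rfl
    rw [Polynomial.ext_iff] at this
    have := this k
    rw [Polynomial.coeff_map] at this
    exact this.symm
  simp_rw [h]
  refine (MvPolynomial.continuous_eval _).comp (continuous_pi fun p => ?_)
  exact (continuous_apply p.2).comp (continuous_apply p.1)

theorem charpoly_eq_of_coeffs {N : ℕ} {A B : Matrix (Fin N) (Fin N) ℂ}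
    (h : charCoeffs A = charCoeffs B) : A.charpoly = B.charpoly := by
  have hA : A.charpoly.natDegree = N := by simp
  have hB : B.charpoly.natDegree = N := by simp
  ext k
  rcases lt_trichotomy k N with hk | hk | hk
  · exact congrFun h ⟨k, hk⟩
  · have h1 := A.charpoly_monic.coeff_natDegree
    have h2 := B.charpoly_monic.coeff_natDegree
    rw [hA] at h1
    rw [hB] at h2
    rw [hk, h1, h2]
  · rw [Polynomial.coeff_eq_zero_of_natDegree_lt (by omega),
      Polynomial.coeff_eq_zero_of_natDegree_lt (by omega)]

theorem roots_charpoly_diagonal {N : ℕ} (E : Fin N → ℂ) :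
    (Matrix.diagonal E).charpoly.roots = Finset.univ.val.map E := by
  rw [Matrix.charpoly_diagonal]
  have h : (∏ i, (Polynomial.X - Polynomial.C (E i))) =
      ((Finset.univ.val.map E).map fun a => Polynomial.X - Polynomial.C a).prod := by
    rw [Multiset.map_map]
    rfl
  rw [h, Polynomial.roots_multiset_prod_X_sub_C]

theorem isClosedMap_charCoeffs_diagonal (N : ℕ) :
    IsClosedMap fun E : Fin N → ℂ => charCoeffs (Matrix.diagonal E) := by
  have hb : ∀ E : Fin N → ℂ, ‖E‖ ≤ ‖charCoeffs (Matrix.diagonal E)‖ + 1 := by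
    intro E
    refine (pi_norm_le_iff_of_nonneg (by positivity)).2 fun i => ?_
    set p := (Matrix.diagonal E).charpoly with hp
    have hm : p.Monic := (Matrix.diagonal E).charpoly_monic
    have hd : p.natDegree = N := by simp [hp]
    have hr : p.IsRoot (E i) := by
      refine (Polynomial.mem_roots hm.ne_zero).1 ?_
      rw [hp, roots_charpoly_diagonal]
      exact Multiset.mem_map_of_mem _ (Finset.mem_univ i)
    have h1 := hr.norm_lt_cauchyBound hm.ne_zero
    have h2 : (p.cauchyBound : NNReal) ≤ ‖charCoeffs (Matrix.diagonal E)‖₊ + 1 := by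
      rw [Polynomial.cauchyBound, hm.leadingCoeff, nnnorm_one, div_one]
      gcongr
      refine Finset.sup_le fun k hk => ?_
      rw [Finset.mem_range, hd] at hk
      exact nnnorm_le_pi_nnnorm (charCoeffs (Matrix.diagonal E)) ⟨k, hk⟩
    have h3 : (p.cauchyBound : ℝ) ≤ ‖charCoeffs (Matrix.diagonal E)‖ + 1 := by exact_mod_cast h2
    have h4 : ‖E i‖ < (p.cauchyBound : ℝ) := by exact_mod_cast h1
    linarith
  refine IsProperMap.isClosedMap (isProperMap_iff_tendsto_cocompact.2 ⟨?_, ?_⟩)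
  · exact continuous_pi fun k => (continuous_charpoly_coeff (k : ℕ)).comp (by fun_prop)
  · rw [← Metric.cobounded_eq_cocompact,
      ← tendsto_norm_atTop_iff_cobounded]
    have h5 : Filter.Tendsto (fun E : Fin N → ℂ => ‖E‖ - 1) (Bornology.cobounded _)
        Filter.atTop := Filter.tendsto_atTop_add_const_right _ _ tendsto_norm_cobounded_atTop
    exact Filter.tendsto_atTop_mono (fun E => by linarith [hb E]) h5

theorem continuous_eigenvalueConf (N : ℕ) :
    Continuous fun A : {A : Matrix (Fin N) (Fin N) ℂ // A.charpoly.roots.Nodup} =>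
      eigenvalueConf A.1 A.2 := by
  rw [continuous_iff_isClosed]
  intro Z hZ
  have hZ' : IsClosed ((Quotient.mk (ordConfSetoid N)) ⁻¹' Z) := hZ.preimage continuous_quotient_mk'
  obtain ⟨W, hW, hWZ⟩ := isClosed_induced_iff.1 hZ'
  have key : (fun A : {A : Matrix (Fin N) (Fin N) ℂ // A.charpoly.roots.Nodup} =>
      eigenvalueConf A.1 A.2) ⁻¹' Z = (fun A => charCoeffs A.1) ⁻¹'
        ((fun E : Fin N → ℂ => charCoeffs (Matrix.diagonal E)) '' W) := by
    ext ⟨A, hA⟩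
    constructor
    · intro h
      have h2 : (⟨eigenvalueTuple A, injective_of_map_roots (eigenvalueTuple_spec A) hA⟩ :
          OrdConf N) ∈ (Quotient.mk (ordConfSetoid N)) ⁻¹' Z := h
      rw [← hWZ] at h2
      refine ⟨eigenvalueTuple A, h2, ?_⟩
      have : (Matrix.diagonal (eigenvalueTuple A)).charpoly = A.charpoly := by
        rw [Matrix.charpoly_diagonal,
          (IsAlgClosed.splits A.charpoly).eq_prod_roots_of_monic A.charpoly_monic,
          ← eigenvalueTuple_spec A, Multiset.map_map]
        rfl
      funext k
      simp only [charCoeffs, this]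
    · rintro ⟨E, hE, h⟩
      have h1 := charpoly_eq_of_coeffs h
      have h2 : Finset.univ.val.map E = A.charpoly.roots := by
        rw [← h1, roots_charpoly_diagonal]
      have h3 : (⟨E, injective_of_map_roots h2 hA⟩ : OrdConf N) ∈
          (Quotient.mk (ordConfSetoid N)) ⁻¹' Z := by
        rw [← hWZ]
        exact hE
      show eigenvalueConf A hA ∈ Z
      rw [eigenvalueConf_eq_mk hA ⟨E, injective_of_map_roots h2 hA⟩ h2]
      exact h3
  rw [key]
  refine (isClosedMap_charCoeffs_diagonal N W hW).preimage ?_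
  exact continuous_pi fun k : Fin N =>
    (continuous_charpoly_coeff (k : ℕ)).comp continuous_subtype_val

/-! ### The eigenvalue braid along a loop -/

section Hamiltonian

variable {K : Type*} [TopologicalSpace K] {N : ℕ}

/-- The bands of `H` are separable along `Γ`: at every point of `Γ` the `N` eigenvalues are
pairwise distinct. -/
def SeparableAlong (H : K → Matrix (Fin N) (Fin N) ℂ) {k₀ : K} (Γ : Path k₀ k₀) : Prop :=
  ∀ t : I, (H (Γ t)).charpoly.roots.Nodup

theorem SeparableAlong.base {H : K → Matrix (Fin N) (Fin N) ℂ} {k₀ : K} {Γ : Path k₀ k₀}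
    (hs : SeparableAlong H Γ) : (H k₀).charpoly.roots.Nodup := by
  simpa using hs 0

theorem continuous_along {H : K → Matrix (Fin N) (Fin N) ℂ} {k₀ : K} {Γ : Path k₀ k₀}
    (hH : ContinuousOn H (Set.range Γ)) : Continuous fun t : I => H (Γ t) :=
  hH.comp_continuous Γ.continuous fun t => Set.mem_range_self t

theorem continuous_eigenvalueConf_along {H : K → Matrix (Fin N) (Fin N) ℂ} {k₀ : K}
    {Γ : Path k₀ k₀} (hH : ContinuousOn H (Set.range Γ)) (hs : SeparableAlong H Γ) :
    Continuous fun t : I => eigenvalueConf (H (Γ t)) (hs t) := by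
  have h : Continuous fun t : I =>
      (⟨H (Γ t), hs t⟩ : {A : Matrix (Fin N) (Fin N) ℂ // A.charpoly.roots.Nodup}) :=
    (continuous_along hH).subtype_mk _
  have h' := (continuous_eigenvalueConf N).comp h
  rw [Function.comp_def] at h'
  exact h'

/-- The loop of eigenvalue configurations of `H` along `Γ`. -/
noncomputable def eigenvalueLoop (H : K → Matrix (Fin N) (Fin N) ℂ) {k₀ : K} (Γ : Path k₀ k₀)
    (hH : ContinuousOn H (Set.range Γ)) (hs : SeparableAlong H Γ) :
    Path (eigenvalueConf (H k₀) hs.base) (eigenvalueConf (H k₀) hs.base) where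
  toFun t := eigenvalueConf (H (Γ t)) (hs t)
  continuous_toFun := continuous_eigenvalueConf_along hH hs
  source' := eigenvalueConf_congr (by rw [Γ.source]) _ _
  target' := eigenvalueConf_congr (by rw [Γ.target]) _ _

/-- The eigenvalue braid of `H` along `Γ`. The path `α` from the base configuration to the
eigenvalue configuration at the base point of `Γ` identifies the fundamental group at the latter
with the braid group; another choice of `α` replaces the braid by a conjugate. The straight-line
motion that keeps the order of the real parts is one choice. -/
noncomputable def eigenvalueBraid (H : K → Matrix (Fin N) (Fin N) ℂ) {k₀ : K} (Γ : Path k₀ k₀)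
    (hH : ContinuousOn H (Set.range Γ)) (hs : SeparableAlong H Γ)
    (α : Path (baseConf N) (eigenvalueConf (H k₀) hs.base)) : BraidGroup N :=
  FundamentalGroup.fromPath
    (Path.Homotopic.Quotient.mk ((α.trans (eigenvalueLoop H Γ hH hs)).trans α.symm))

/-! ### The discriminant number along a loop -/

/-- The discriminant of the characteristic polynomial of `H` along `Γ`. -/
noncomputable def discriminantAlong (H : K → Matrix (Fin N) (Fin N) ℂ) {k₀ : K} (Γ : Path k₀ k₀)
    (t : I) : ℂ :=
  (H (Γ t)).charpoly.discr

end Hamiltonian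

theorem continuous_charpoly_discr (N : ℕ) :
    Continuous fun A : Matrix (Fin N) (Fin N) ℂ => A.charpoly.discr := by
  rcases Nat.eq_zero_or_pos N with rfl | hN
  · exact continuous_of_discreteTopology
  · have h : ∀ A : Matrix (Fin N) (Fin N) ℂ, A.charpoly.discr =
        (-1) ^ (N * (N - 1) / 2) *
          (Polynomial.sylvester A.charpoly A.charpoly.derivative N (N - 1)).det := by
      intro A
      have hd : A.charpoly.natDegree = N := by simp
      have := Polynomial.resultant_deriv (f := A.charpoly)
        (Polynomial.natDegree_pos_iff_degree_pos.1 (by omega))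
      rw [hd, A.charpoly_monic.leadingCoeff, mul_one, Polynomial.resultant] at this
      rw [this, ← mul_assoc, ← pow_add, ← two_mul, pow_mul]
      simp
    simp_rw [h]
    refine continuous_const.mul (Continuous.matrix_det ?_)
    refine continuous_matrix fun i j => ?_
    simp only [Polynomial.sylvester, Matrix.of_apply]
    refine Fin.addCases (fun j => ?_) (fun j => ?_) j
    · simp only [Fin.addCases_left, Polynomial.coeff_derivative]
      split_ifs
      · exact (continuous_charpoly_coeff _).mul continuous_const
      · exact continuous_const
    · simp only [Fin.addCases_right]
      split_ifs
      · exact continuous_charpoly_coeff _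
      · exact continuous_const

theorem charpoly_discr_ne_zero {N : ℕ} {A : Matrix (Fin N) (Fin N) ℂ}
    (h : A.charpoly.roots.Nodup) : A.charpoly.discr ≠ 0 := by
  have hd : A.charpoly.natDegree = N := by simp
  rcases Nat.eq_zero_or_pos N with rfl | hN
  · rw [A.charpoly_monic.natDegree_eq_zero.1 hd, ← Polynomial.C_1, Polynomial.discr_C]
    exact one_ne_zero
  · intro h0
    have h1 := Polynomial.resultant_deriv (f := A.charpoly)
      (Polynomial.natDegree_pos_iff_degree_pos.1 (by omega))
    rw [h0, mul_zero, ← Polynomial.natDegree_derivative,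
      Polynomial.resultant_eq_zero_iff] at h1
    exact h1.2 ((Polynomial.nodup_roots_iff_of_splits A.charpoly_monic.ne_zero
      (IsAlgClosed.splits _)).1 h)

/-- Every continuous curve of nonzero complex numbers has a continuous argument. -/
theorem exists_continuous_argument {z : I → ℂ} (hc : Continuous z) (h0 : ∀ t, z t ≠ 0) :
    ∃ θ : I → ℝ, Continuous θ ∧ ∀ t, z t = ‖z t‖ * Complex.exp (θ t * Complex.I) := by
  obtain ⟨L, hL, -⟩ := Complex.isCoveringMap_exp.exists_path_lifts
    ⟨fun t => (⟨z t, h0 t⟩ : {z : ℂ // z ≠ 0}), hc.subtype_mk _⟩ (Complex.log (z 0))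
    (Subtype.ext (Complex.exp_log (h0 0)).symm)
  have h : ∀ t, Complex.exp (L t) = z t := fun t => congrArg Subtype.val (congrFun hL t)
  refine ⟨fun t => (L t).im, Complex.continuous_im.comp L.continuous, fun t => ?_⟩
  rw [← h t, Complex.norm_exp, Complex.ofReal_exp, ← Complex.exp_add, Complex.re_add_im]

/-- The total variation `∮ d arg z` of the argument along a continuous curve of nonzero complex
numbers: the increment of a continuous argument. -/
noncomputable def argVariation {z : I → ℂ} (hc : Continuous z) (h0 : ∀ t, z t ≠ 0) : ℝ :=
  (exists_continuous_argument hc h0).choose 1 - (exists_continuous_argument hc h0).choose 0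

/-- The total variation of the argument does not depend on the continuous argument used. -/
theorem argVariation_eq {z : I → ℂ} (hc : Continuous z) (h0 : ∀ t, z t ≠ 0) {θ : I → ℝ}
    (hθ : Continuous θ) (hz : ∀ t, z t = ‖z t‖ * Complex.exp (θ t * Complex.I)) :
    argVariation hc h0 = θ 1 - θ 0 := by
  set η := (exists_continuous_argument hc h0).choose with hη
  obtain ⟨h1, h2⟩ := (exists_continuous_argument hc h0).choose_spec
  rw [← hη] at h1 h2
  have h3 : ∀ t, ∃ n : ℤ, (η t - θ t) / (2 * Real.pi) = n := by
    intro t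
    have h4 : Complex.exp (η t * Complex.I) = Complex.exp (θ t * Complex.I) := by
      have h5 : (‖z t‖ : ℂ) ≠ 0 := by exact_mod_cast norm_ne_zero_iff.2 (h0 t)
      exact mul_left_cancel₀ h5 ((h2 t).symm.trans (hz t))
    obtain ⟨n, hn⟩ := Complex.exp_eq_exp_iff_exists_int.1 h4
    refine ⟨n, ?_⟩
    have h6 : (η t : ℂ) = θ t + n * (2 * Real.pi) := by
      have := Complex.I_ne_zero
      apply mul_right_cancel₀ this
      linear_combination hn
    have h7 : η t = θ t + n * (2 * Real.pi) := by exact_mod_cast h6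
    rw [h7]
    field_simp
    ring
  have h8 : (η 1 - θ 1) / (2 * Real.pi) = (η 0 - θ 0) / (2 * Real.pi) := by
    have hcont : Continuous fun t => (η t - θ t) / (2 * Real.pi) := by fun_prop
    choose n hn using h3
    have hcn : Continuous n := by
      refine Int.isClosedEmbedding_coe_real.isEmbedding.continuous_iff.2 ?_
      convert hcont using 1
      funext t
      exact (hn t).symm
    rw [hn, hn, PreconnectedSpace.constant inferInstance hcn]
  have h9 : η 1 - θ 1 = η 0 - θ 0 := by
    field_simp at h8
    exact h8
  show η 1 - η 0 = θ 1 - θ 0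
  linarith

/-- The discriminant number `(2π)⁻¹ ∮ d arg Δ` of `H` along `Γ`, where `Δ` is the discriminant of
the characteristic polynomial. -/
noncomputable def discriminantNumber {K : Type*} [TopologicalSpace K] {N : ℕ}
    (H : K → Matrix (Fin N) (Fin N) ℂ) {k₀ : K} (Γ : Path k₀ k₀)
    (hH : ContinuousOn H (Set.range Γ)) (hs : SeparableAlong H Γ) : ℝ :=
  argVariation (z := discriminantAlong H Γ)
    ((continuous_charpoly_discr N).comp (continuous_along hH))
    (fun t => charpoly_discr_ne_zero (hs t)) / (2 * Real.pi)

/-! The discriminant depends only on the spectrum, so it is a nowhere vanishing continuous function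
on `UConf N`, and its winding number around 0 is a homomorphism `discriminantHom` from the braid
group to ℤ. The connecting path is traversed forth and back and contributes nothing, so the value at
an eigenvalue braid is the discriminant number. Up to a constant sign the discriminant is the
product of the differences of the points over all ordered pairs. Along a half twist only the two
differences of the exchanged points turn, by π each, so every generator has value 1
(`pathArg_halfTwist`).

The exponent sum formula then needs that the half twists generate (`halfTwistSubgroup_eq_top`). A
straight path leads from the base configuration to any configuration, for each labelling by
increasing real part. Such a labelling is ambiguous only between points with equal real part, and
exchanging two neighbouring labels changes the straight path by a half twist or its inverse
(`loopDiff_straightClass_swap`). A short motion can be deformed so that a labelling sorting its end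
sorts it throughout, and a long motion is cut into short ones (`isTwistProduct`). Loops of
unlabelled points lift to labelled motions, because forgetting labels is a covering.

For the kernel, consider points on a vertical line: every labelling is sorted there, and two ways to
reverse three neighbours give the braid relation. It makes all generators equal in the
abelianization, which is therefore cyclic, and a braid with exponent sum 0 becomes trivial in it.
Finally, every braid is realized by a matrix family over `UConf N` itself, given by companion
matrices. -/

/-! ### Homotopies of paths -/

section Homotopy

variable {X : Type*} [TopologicalSpace X]

open Path.Homotopic (Quotient)

/-- Two paths that lift to paths with common endpoints in a simply connected space are
homotopic. -/
theorem Path.Homotopic.of_simplyConnected {A : Type*} [TopologicalSpace A] [SimplyConnectedSpace A]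
    {f : A → X} (hf : Continuous f) {a b : A} {x y : X} {p q : Path x y} (P Q : Path a b)
    (hP : ∀ t, f (P t) = p t) (hQ : ∀ t, f (Q t) = q t) : p.Homotopic q := by
  obtain rfl : f a = x := by simpa using hP 0
  obtain rfl : f b = y := by simpa using hP 1
  have h := (SimplyConnectedSpace.paths_homotopic P Q).map ⟨f, hf⟩
  have hp : P.map hf = p := Path.ext (funext hP)
  have hq : Q.map hf = q := Path.ext (funext hQ)
  rw [← hp, ← hq]
  exact h

/-- The two ways around a continuous square are homotopic. -/
theorem Path.Homotopic.of_square {H : I × I → X} {x₀₀ x₀₁ x₁₀ x₁₁ : X}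
    (hH : Continuous H) {p₀ : Path x₀₀ x₀₁} {p₁ : Path x₁₀ x₁₁} {q₀ : Path x₀₀ x₁₀}
    {q₁ : Path x₀₁ x₁₁} (hp₀ : ∀ t, H (0, t) = p₀ t) (hp₁ : ∀ t, H (1, t) = p₁ t)
    (hq₀ : ∀ t, H (t, 0) = q₀ t) (hq₁ : ∀ t, H (t, 1) = q₁ t) :
    (p₀.trans q₁).Homotopic (q₀.trans p₁) := by
  -- The square is contractible, so its two boundary paths from corner to opposite corner are
  -- homotopic before `H` is applied.
  have : ContractibleSpace I := (convex_Icc (0 : ℝ) 1).contractibleSpace ⟨0, by simp⟩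
  let idI : Path (0 : I) 1 := ⟨.id I, rfl, rfl⟩
  refine Path.Homotopic.of_simplyConnected hH
    (((Path.refl (0 : I)).prod idI).trans (idI.prod (Path.refl (1 : I))))
    ((idI.prod (Path.refl (0 : I))).trans ((Path.refl (1 : I)).prod idI)) ?_ ?_
  · intro t
    simp only [Path.trans_apply]
    split_ifs
    · exact hp₀ _
    · exact hq₁ _
  · intro t
    simp only [Path.trans_apply]
    split_ifs
    · exact hq₀ _
    · exact hp₁ _

variable {x y z : X}

/-- The loop that goes along the first path and returns along the second. -/
noncomputable def loopDiff (p q : Quotient x y) : FundamentalGroup X x :=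
  FundamentalGroup.fromPath (p.trans q.symm)

theorem loopDiff_self (p : Quotient x y) : loopDiff p p = 1 :=
  Path.Homotopic.Quotient.trans_symm p

/-- Telescoping, which is used to split a comparison of two paths into elementary ones. In a product
in `FundamentalGroup` the right factor is traversed first. -/
theorem loopDiff_mul (p q r : Quotient x y) : loopDiff q r * loopDiff p q = loopDiff p r := by
  show (p.trans q.symm).trans (q.trans r.symm) = p.trans r.symm
  rw [Path.Homotopic.Quotient.trans_assoc, ← Path.Homotopic.Quotient.trans_assoc q.symm,
    Path.Homotopic.Quotient.symm_trans, Path.Homotopic.Quotient.refl_trans]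

theorem loopDiff_inv (p q : Quotient x y) : (loopDiff p q)⁻¹ = loopDiff q p := by
  rw [inv_eq_iff_mul_eq_one, loopDiff_mul, loopDiff_self]

/-- The common tail cancels against its reverse. -/
theorem loopDiff_trans (p q : Quotient x y) (r : Quotient y z) :
    loopDiff (p.trans r) (q.trans r) = loopDiff p q := by
  induction p using Path.Homotopic.Quotient.ind with | mk p
  induction q using Path.Homotopic.Quotient.ind with | mk q
  induction r using Path.Homotopic.Quotient.ind with | mk r
  show Path.Homotopic.Quotient.mk ((p.trans r).trans (q.trans r).symm) =
    Path.Homotopic.Quotient.mk (p.trans q.symm)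
  simp only [Path.trans_symm, Path.Homotopic.Quotient.mk_trans]
  rw [
    Path.Homotopic.Quotient.trans_assoc,
    ← Path.Homotopic.Quotient.trans_assoc (Path.Homotopic.Quotient.mk r),
    Path.Homotopic.Quotient.mk_symm,
    Path.Homotopic.Quotient.trans_symm, Path.Homotopic.Quotient.refl_trans]

theorem loopDiff_eq_of_trans_eq {p q : Quotient x y} {r : Quotient x x} (h : r.trans q = p) :
    loopDiff p q = FundamentalGroup.fromPath r := by
  show p.trans q.symm = r
  rw [← h, Path.Homotopic.Quotient.trans_assoc, Path.Homotopic.Quotient.trans_symm,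
    Path.Homotopic.Quotient.trans_refl]

end Homotopy

/-! ### Straight paths from the base configuration -/

section Straight

variable {N : ℕ}

/-- The relabelling `s` lists the points of `E` by increasing real part. -/
def SortsRe (E : Fin N → ℂ) (s : Equiv.Perm (Fin N)) : Prop := Monotone fun j => (E (s j)).re

/-- Before the end of the motion the strictly increasing real parts of `B` still have positive
weight, so the points are separated by their real parts; at the end `E` is injective itself. -/
theorem straight_injective {B E : Fin N → ℂ} (hB : StrictMono fun j => (B j).re)
    (hE : Monotone fun j => (E j).re) (hE' : Function.Injective E) {t : ℝ} (h0 : 0 ≤ t)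
    (h1 : t ≤ 1) : Function.Injective fun j => (1 - t : ℂ) * B j + t * E j := by
  rcases eq_or_lt_of_le h1 with rfl | h1
  · simpa using hE'
  · have : StrictMono fun j => (((1 - t : ℂ) * B j + t * E j)).re := by
      intro i j hij
      have e1 := hB hij
      have e2 := hE hij.le
      simp only [← Complex.ofReal_one, ← Complex.ofReal_sub, Complex.add_re,
        Complex.re_ofReal_mul] at *
      nlinarith [mul_le_mul_of_nonneg_left e2 h0, mul_lt_mul_of_pos_left e1 (sub_pos.2 h1)]
    intro i j h
    exact this.injective (congrArg Complex.re h)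

theorem continuous_mk_conf : Continuous fun E : OrdConf N => (⟦E⟧ : UConf N) :=
  continuous_quotient_mk'

theorem mk_conf_eq {E E' : OrdConf N} (s : Equiv.Perm (Fin N)) (h : ∀ j, E'.1 j = E.1 (s j)) :
    (⟦E⟧ : UConf N) = ⟦E'⟧ :=
  Quotient.sound ⟨s, h⟩

theorem strictMono_baseTuple : StrictMono fun j : Fin N => ((baseTuple N).1 j).re := by
  intro i j h
  simpa [baseTuple] using h

/-- The straight motion of the points of the base configuration to those of `E`, where the points
of `E` are labelled by means of `s`. -/
noncomputable def straightTuple (E : OrdConf N) (s : Equiv.Perm (Fin N)) (t : ℝ) (j : Fin N) : ℂ :=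
  (1 - t : ℂ) * (baseTuple N).1 j + t * E.1 (s j)

theorem straightTuple_injective {E : OrdConf N} {s : Equiv.Perm (Fin N)} (hs : SortsRe E.1 s)
    (t : I) : Function.Injective (straightTuple E s t) :=
  straight_injective strictMono_baseTuple hs (E.2.comp s.injective) t.2.1 t.2.2

/-- The straight path from the base configuration to `E`. -/
noncomputable def straightPath (E : OrdConf N) (s : Equiv.Perm (Fin N)) (hs : SortsRe E.1 s) :
    Path (baseConf N) ⟦E⟧ where
  toFun t := ⟦⟨straightTuple E s t, straightTuple_injective hs t⟩⟧
  continuous_toFun := by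
    refine continuous_mk_conf.comp (Continuous.subtype_mk ?_ _)
    unfold straightTuple
    fun_prop
  source' := congrArg _ (Subtype.ext (funext fun j => by simp [straightTuple]))
  target' := (mk_conf_eq s fun j => by simp [straightTuple]).symm

/-- The class of the straight path from the base configuration to `E`. -/
noncomputable def straightClass (E : OrdConf N) (s : Equiv.Perm (Fin N)) (hs : SortsRe E.1 s) :
    Path.Homotopic.Quotient (baseConf N) ⟦E⟧ :=
  Path.Homotopic.Quotient.mk (straightPath E s hs)

/-- Along a motion whose points remain sorted the straight path changes by the motion. -/
theorem straightClass_trans {E E' : OrdConf N} (p : Path E E') (s : Equiv.Perm (Fin N))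
    (h : ∀ t, SortsRe (p t).1 s) (hs : SortsRe E.1 s) (hs' : SortsRe E'.1 s) :
    (straightClass E s hs).trans (Path.Homotopic.Quotient.mk (p.map continuous_mk_conf)) =
      straightClass E' s hs' := by
  -- The straight paths to the points of `p` sweep out a square, one side of which is constant at
  -- the base configuration.
  have key := Path.Homotopic.of_square (X := UConf N)
    (H := fun z => ⟦⟨straightTuple (p z.1) s z.2, straightTuple_injective (h z.1) z.2⟩⟧)
    (p₀ := straightPath E s hs) (p₁ := straightPath E' s hs') (q₀ := Path.refl _)
    (q₁ := p.map continuous_mk_conf) ?_ ?_ ?_ ?_ ?_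
  · have := Path.Homotopic.Quotient.eq.2 key
    rw [Path.Homotopic.Quotient.mk_trans, Path.Homotopic.Quotient.mk_trans] at this
    exact this.trans (Path.Homotopic.Quotient.refl_trans _)
  · refine continuous_mk_conf.comp (Continuous.subtype_mk (continuous_pi fun j => ?_) _)
    have : Continuous fun z : I × I => (p z.1).1 (s j) :=
      (continuous_apply (s j)).comp
        (continuous_subtype_val.comp (p.continuous.comp continuous_fst))
    exact (((by fun_prop : Continuous fun z : I × I => (1 - ((z.2 : ℝ) : ℂ))).mul
      continuous_const).add ((by fun_prop : Continuous fun z : I × I => ((z.2 : ℝ) : ℂ)).mul this))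
  · intro t
    exact congrArg _ (Subtype.ext (funext fun j => by simp [straightTuple]))
  · intro t
    exact congrArg _ (Subtype.ext (funext fun j => by simp [straightTuple]))
  · intro t
    exact congrArg _ (Subtype.ext (funext fun j => by simp [straightTuple]))
  · intro t
    exact (mk_conf_eq s fun j => by simp [straightTuple]).symm

/-- The turning points keep their real parts in [k, k + 1], and all others rest at integers outside
this interval. -/
theorem halfTwistFun_re_lt (k : Fin (N - 1)) (t : ℝ) {i j : Fin N} (hij : i < j)
    (hc : ¬((i : ℕ) = k ∧ (j : ℕ) = k + 1)) :
    (halfTwistFun k t i).re < (halfTwistFun k t j).re := by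
  set w := Complex.exp (Real.pi * t * Complex.I) with hw
  have hw1 : |w.re| ≤ 1 := by
    have := Complex.abs_re_le_norm w
    rwa [halfTwist_norm t] at this
  have hre1 : ∀ j : Fin N, (j : ℕ) ≠ k → (j : ℕ) ≠ k + 1 → (halfTwistFun k t j).re = (j : ℕ) := by
    intro j h1 h2
    simp [halfTwistFun, h1, h2]
  have hre2 : ∀ j : Fin N, ((j : ℕ) = k ∨ (j : ℕ) = k + 1) →
      ((k : ℕ) : ℝ) ≤ (halfTwistFun k t j).re ∧ (halfTwistFun k t j).re ≤ (k : ℕ) + 1 := by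
    have := abs_le.1 hw1
    rintro j (h | h)
    · simp only [halfTwistFun, h, ← hw, if_true]
      simp
      constructor <;> linarith
    · simp only [halfTwistFun, h, ← hw, if_true]
      simp
      constructor <;> linarith
  have hij' : (i : ℕ) < j := hij
  have hij'' : ((i : ℕ) : ℝ) + 1 ≤ (j : ℕ) := by exact_mod_cast hij'
  by_cases hi : (i : ℕ) = k ∨ (i : ℕ) = k + 1
  · have h5 := (hre2 i hi).2
    have h6 : ((k : ℕ) : ℝ) + 1 < (j : ℕ) := by
      have : (k : ℕ) + 1 < (j : ℕ) := by omega
      exact_mod_cast this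
    rw [hre1 j (by omega) (by omega)]
    linarith
  · rw [hre1 i (by tauto) (by tauto)]
    by_cases hj : (j : ℕ) = k ∨ (j : ℕ) = k + 1
    · have h5 := (hre2 j hj).1
      have h6 : ((i : ℕ) : ℝ) < (k : ℕ) := by
        have : (i : ℕ) < (k : ℕ) := by omega
        exact_mod_cast this
      linarith
    · rw [hre1 j (by tauto) (by tauto)]
      linarith

/-- In a counterclockwise half twist the left point passes below the right one. This agrees with
`him`, so imaginary parts separate the exchanged pair, while real parts separate every other pair.
-/
theorem straight_halfTwist_injective (E : OrdConf N) (s : Equiv.Perm (Fin N)) (hs : SortsRe E.1 s)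
    (k : Fin (N - 1)) {a b : Fin N} (ha : (a : ℕ) = k) (hb : (b : ℕ) = k + 1)
    (hre : (E.1 (s a)).re = (E.1 (s b)).re) (him : (E.1 (s a)).im < (E.1 (s b)).im)
    {u t : ℝ} (hu : u ∈ I) (ht : t ∈ I) :
    Function.Injective fun j => (1 - u : ℂ) * halfTwistFun k t j + u * E.1 (s j) := by
  rcases eq_or_lt_of_le hu.1 with rfl | hu0
  · simpa using halfTwistFun_injective k t
  rcases eq_or_lt_of_le hu.2 with rfl | hu1
  · simpa [Function.comp_def] using E.2.comp s.injective
  set w := Complex.exp (Real.pi * t * Complex.I) with hw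
  -- Here `t ∈ [0, 1]` enters: the angle π t stays in the upper half turn.
  have hw2 : 0 ≤ w.im := by
    have : w = Complex.exp ((Real.pi * t : ℝ) * Complex.I) := by rw [hw]; push_cast; rfl
    rw [this, Complex.exp_ofReal_mul_I_im]
    exact Real.sin_nonneg_of_nonneg_of_le_pi (by have := Real.pi_pos; have := ht.1; positivity)
      (by nlinarith [Real.pi_pos, ht.2])
  have hlt : ∀ i j : Fin N, i < j → (1 - u : ℂ) * halfTwistFun k t i + u * E.1 (s i) ≠
      (1 - u : ℂ) * halfTwistFun k t j + u * E.1 (s j) := by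
    intro i j hij h
    by_cases hc : (i : ℕ) = k ∧ (j : ℕ) = k + 1
    · obtain rfl : i = a := Fin.ext (by omega)
      obtain rfl : j = b := Fin.ext (by omega)
      have h2 := congrArg Complex.im h
      simp only [halfTwistFun, ha, hb, ← hw, if_true, ← Complex.ofReal_one, ← Complex.ofReal_sub,
        Complex.add_im, Complex.im_ofReal_mul] at h2
      simp at h2
      nlinarith [mul_lt_mul_of_pos_left him hu0, mul_nonneg (sub_pos.2 hu1).le hw2]
    · have h2 := congrArg Complex.re h
      simp only [← Complex.ofReal_one, ← Complex.ofReal_sub,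
        Complex.add_re, Complex.re_ofReal_mul] at h2
      have h3 : (E.1 (s i)).re ≤ (E.1 (s j)).re := hs hij.le
      have h4 := halfTwistFun_re_lt k t hij hc
      nlinarith [mul_le_mul_of_nonneg_left h3 hu0.le, mul_lt_mul_of_pos_left h4 (sub_pos.2 hu1)]
  intro i j h
  rcases lt_trichotomy i j with hij | hij | hij
  · exact absurd h (hlt i j hij)
  · exact hij
  · exact absurd h.symm (hlt j i hij)

theorem halfTwistFun_one (k : Fin (N - 1)) {a b : Fin N} (ha : (a : ℕ) = k)
    (hb : (b : ℕ) = k + 1) (j : Fin N) :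
    halfTwistFun k 1 j = (baseTuple N).1 (Equiv.swap a b j) := by
  simp only [halfTwistFun, Complex.ofReal_one, mul_one, Complex.exp_pi_mul_I,
    Equiv.swap_apply_def, baseTuple]
  by_cases h1 : j = a
  · subst h1
    rw [if_pos ha, if_pos rfl, hb]
    push_cast
    ring
  · by_cases h2 : j = b
    · subst h2
      rw [if_neg (by omega), if_pos hb, if_neg h1, if_pos rfl, ha]
      ring
    · rw [if_neg (by rw [← ha]; intro h; exact h1 (Fin.ext h)),
        if_neg (by rw [← hb]; intro h; exact h2 (Fin.ext h)), if_neg h1, if_neg h2]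

/-- If two points that are neighbours in the order of `s` have the same real part, then their
transposition changes the straight path by a half twist. -/
theorem loopDiff_straightClass_swap (E : OrdConf N) (s : Equiv.Perm (Fin N)) (hs : SortsRe E.1 s)
    (k : Fin (N - 1)) {a b : Fin N} (ha : (a : ℕ) = k) (hb : (b : ℕ) = k + 1)
    (hre : (E.1 (s a)).re = (E.1 (s b)).re) (him : (E.1 (s a)).im < (E.1 (s b)).im)
    (hs' : SortsRe E.1 (s * Equiv.swap a b)) :
    loopDiff (straightClass E s hs) (straightClass E (s * Equiv.swap a b) hs') = braidGen k := by
  refine loopDiff_eq_of_trans_eq (r := Path.Homotopic.Quotient.mk (halfTwist k)) ?_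
  -- The square contracts the half twist to the constant loop at `E`. Its sides at times 0 and 1 of
  -- the twist are the two straight paths, the second up to relabelling by the transposition.
  have key := Path.Homotopic.of_square (X := UConf N)
    (H := fun z => ⟦⟨fun j => (1 - (z.1 : ℝ) : ℂ) * halfTwistFun k z.2 j + (z.1 : ℝ) * E.1 (s j),
      straight_halfTwist_injective E s hs k ha hb hre him z.1.2 z.2.2⟩⟧)
    (p₀ := halfTwist k) (p₁ := Path.refl _) (q₀ := straightPath E s hs)
    (q₁ := straightPath E (s * Equiv.swap a b) hs') ?_ ?_ ?_ ?_ ?_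
  · have := Path.Homotopic.Quotient.eq.2 key
    rw [Path.Homotopic.Quotient.mk_trans, Path.Homotopic.Quotient.mk_trans] at this
    exact this.trans (Path.Homotopic.Quotient.trans_refl _)
  · refine continuous_mk_conf.comp (Continuous.subtype_mk (continuous_pi fun j => ?_) _)
    unfold halfTwistFun
    split_ifs <;> fun_prop
  · intro t
    exact congrArg _ (Subtype.ext (funext fun j => by simp))
  · intro t
    exact (mk_conf_eq s fun j => by simp).symm
  · intro t
    refine congrArg _ (Subtype.ext (funext fun j => ?_))
    have : halfTwistFun k 0 j = (baseTuple N).1 j := by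
      simp only [halfTwistFun, baseTuple, Complex.ofReal_zero, mul_zero, zero_mul, Complex.exp_zero]
      split_ifs with h1 h2
      · rw [h1]; ring
      · rw [h2]; push_cast; ring
      · rfl
    simp [straightTuple, this]
  · intro t
    refine mk_conf_eq (Equiv.swap a b) fun j => ?_
    simp [straightTuple, halfTwistFun_one k ha hb]

end Straight

/-! ### The half twists generate the braid group -/

section Generation

variable {N : ℕ}

/-- The subgroup generated by the half twists. -/
noncomputable def halfTwistSubgroup (N : ℕ) : Subgroup (BraidGroup N) :=
  Subgroup.closure (Set.range braidGen)

theorem braidGen_mem (k : Fin (N - 1)) : braidGen k ∈ halfTwistSubgroup N :=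
  Subgroup.subset_closure ⟨k, rfl⟩

/-- A permutation that increases at every adjacent pair is strictly monotone, hence the identity. -/
theorem exists_descent {π : Equiv.Perm (Fin N)} (hπ : π ≠ 1) :
    ∃ (k : Fin (N - 1)) (a b : Fin N), (a : ℕ) = k ∧ (b : ℕ) = k + 1 ∧ π b < π a := by
  by_contra! h
  apply hπ
  obtain _ | n := N
  · exact Subsingleton.elim _ _
  have hm : StrictMono π := by
    refine Fin.strictMono_iff_lt_succ.2 fun i => lt_of_le_of_ne ?_ ?_
    · exact h i i.castSucc i.succ rfl (by simp)
    · exact fun e => (Fin.castSucc_lt_succ (i := i)).ne (π.injective e)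
  have := (StrictMono.range_inj hm (strictMono_id (α := Fin (n + 1)))).1 (by
    rw [π.surjective.range_eq, Set.range_id])
  exact Equiv.ext fun j => congrFun this j

/-- Two straight paths to the same configuration differ by a product of half twists. -/
theorem loopDiff_straightClass_mem (E : OrdConf N) (s s' : Equiv.Perm (Fin N))
    (hs : SortsRe E.1 s) (hs' : SortsRe E.1 s') :
    loopDiff (straightClass E s hs) (straightClass E s' hs') ∈ halfTwistSubgroup N := by
  obtain ⟨π, rfl⟩ : ∃ π, s' = s * π := ⟨s⁻¹ * s', by group⟩
  -- Bubble sort: undoing a descent of `π` makes its list of values lexicographically smaller.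
  induction h : toLex (π : Fin N → Fin N) using WellFoundedLT.induction generalizing π with
  | ind _ ih =>
    subst h
    by_cases hπ : π = 1
    · subst hπ
      have : straightClass E (s * 1) hs' = straightClass E s hs := by
        congr 1
      rw [this, loopDiff_self]
      exact one_mem _
    obtain ⟨k, a, b, ha, hb, hlt⟩ := exists_descent hπ
    have hab : a < b := by rw [Fin.lt_def]; omega
    -- The two sorted labellings list these points in opposite orders, which forces equal real
    -- parts.
    have hre : (E.1 (s (π a))).re = (E.1 (s (π b))).re :=
      le_antisymm (hs' hab.le) (hs hlt.le)
    have hsort : SortsRe E.1 (s * (π * Equiv.swap a b)) := by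
      have : (fun j => (E.1 ((s * (π * Equiv.swap a b)) j)).re) =
          fun j => (E.1 ((s * π) j)).re := by
        funext j
        simp only [Equiv.Perm.coe_mul, Function.comp_apply, Equiv.swap_apply_def]
        split_ifs with h1 h2
        · rw [h1, hre]
        · rw [h2, hre]
        · rfl
      rw [SortsRe, this]
      exact hs'
    have hlex : toLex ((π * Equiv.swap a b : Equiv.Perm (Fin N)) : Fin N → Fin N) <
        toLex (π : Fin N → Fin N) := by
      refine ⟨a, fun j hj => ?_, ?_⟩
      · simp [Equiv.swap_apply_of_ne_of_ne hj.ne (hj.trans hab).ne]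
      · simpa using hlt
    have h1 := ih _ hlex (π * Equiv.swap a b) hsort rfl
    rw [← loopDiff_mul _ (straightClass E (s * (π * Equiv.swap a b)) hsort)]
    refine mul_mem ?_ h1
    have him : (E.1 (s (π a))).im ≠ (E.1 (s (π b))).im := fun e => by
      have := s.injective (E.2 (Complex.ext hre e))
      exact hlt.ne' this
    -- The twist lemma requires the lower point to have the smaller label. In the first case it
    -- applies to the labelling before the swap and the inverse of a generator appears; in the
    -- second it applies after the swap.
    rcases him.lt_or_gt with him | him
    · rw [← loopDiff_inv]
      exact inv_mem ((loopDiff_straightClass_swap E (s * π) hs' k ha hb hre him hsort) ▸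
        braidGen_mem k)
    · have h2 := loopDiff_straightClass_swap E (s * (π * Equiv.swap a b)) hsort k ha hb
        (by simpa using hre.symm) (by simpa using him)
        (by simpa [mul_assoc] using hs')
      have h3 : straightClass E (s * (π * Equiv.swap a b) * Equiv.swap a b)
          (by simpa [mul_assoc] using hs') = straightClass E (s * π) hs' := by
        congr 1
        simp [mul_assoc]
      rw [h3] at h2
      rw [h2]
      exact braidGen_mem k

/-! ### Motions of labelled points: from short to arbitrary ones -/

theorem exists_sortsRe (E : Fin N → ℂ) : ∃ s, SortsRe E s :=
  ⟨Tuple.sort fun j => (E j).re, Tuple.monotone_sort fun j => (E j).re⟩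

/-- Near a configuration all tuples are configurations, and a relabelling that sorts one of them
sorts the given one. -/
theorem exists_ball_sortsRe (E : OrdConf N) : ∃ ε > 0, ∀ x ∈ Metric.ball E.1 ε,
    Function.Injective x ∧ ∀ s, SortsRe x s → SortsRe E.1 s := by
  refine Metric.eventually_nhds_iff_ball.1 (Filter.Eventually.and ?_ ?_)
  · have h : ∀ i j, i ≠ j → ∀ᶠ x : Fin N → ℂ in nhds E.1, x i ≠ x j := fun i j hij =>
      (isOpen_ne_fun (continuous_apply i) (continuous_apply j)).mem_nhds fun e => hij (E.2 e)
    have h' : ∀ᶠ x : Fin N → ℂ in nhds E.1, ∀ i j, i ≠ j → x i ≠ x j := by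
      simpa only [Filter.eventually_all, Filter.eventually_imp_distrib_left] using h
    filter_upwards [h'] with x hx i j hij
    by_contra hne
    exact hx i j hne hij
  · have h : ∀ i j, (E.1 i).re < (E.1 j).re → ∀ᶠ x : Fin N → ℂ in nhds E.1,
        (x i).re < (x j).re := fun i j hij =>
      ContinuousAt.eventually_lt (Complex.continuous_re.comp (continuous_apply i)).continuousAt
        (Complex.continuous_re.comp (continuous_apply j)).continuousAt hij
    have h' : ∀ᶠ x : Fin N → ℂ in nhds E.1, ∀ i j, (E.1 i).re < (E.1 j).re →
        (x i).re < (x j).re := by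
      simpa only [Filter.eventually_all, Filter.eventually_imp_distrib_left] using h
    filter_upwards [h'] with x hx s hs i j hij
    by_contra hlt
    exact absurd (hs hij) (not_le.2 (hx _ _ (not_le.1 hlt)))

/-- The class of the motion of unlabelled points given by a motion of labelled points. -/
noncomputable def motionClass {E E' : OrdConf N} (p : Path E E') :
    Path.Homotopic.Quotient (⟦E⟧ : UConf N) ⟦E'⟧ :=
  Path.Homotopic.Quotient.mk (p.map continuous_mk_conf)

/-- The motion is a product of half twists, if the ends are joined to the base configuration by
straight paths. -/
def IsTwistProduct {E E' : OrdConf N} (p : Path E E') : Prop :=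
  ∀ s s' (hs : SortsRe E.1 s) (hs' : SortsRe E'.1 s'),
    loopDiff ((straightClass E s hs).trans (motionClass p)) (straightClass E' s' hs') ∈
      halfTwistSubgroup N

theorem IsTwistProduct.symm {E E' : OrdConf N} {p : Path E E'} (h : IsTwistProduct p) :
    IsTwistProduct p.symm := by
  intro s s' hs hs'
  have h1 := h s' s hs' hs
  rw [← loopDiff_trans _ _ (motionClass p)]
  have h2 : ((straightClass E' s hs).trans (motionClass p.symm)).trans (motionClass p) =
      straightClass E' s hs := by
    have : (motionClass p.symm).trans (motionClass p) = Path.Homotopic.Quotient.refl _ :=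
      Path.Homotopic.Quotient.symm_trans (motionClass p)
    rw [Path.Homotopic.Quotient.trans_assoc, this, Path.Homotopic.Quotient.trans_refl]
  rw [h2, ← loopDiff_inv]
  exact inv_mem h1

/-- A straight path to the intermediate configuration is inserted, and the comparison splits into
those for `p` and `q`. -/
theorem IsTwistProduct.of_homotopic {E E' E'' : OrdConf N} {p : Path E E'} {q : Path E' E''}
    {r : Path E E''} (hp : IsTwistProduct p) (hq : IsTwistProduct q)
    (h : (p.trans q).Homotopic r) : IsTwistProduct r := by
  intro s s'' hs hs''
  obtain ⟨s', hs'⟩ := exists_sortsRe E'.1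
  have hr : motionClass r = (motionClass p).trans (motionClass q) := by
    have := (Path.Homotopic.Quotient.eq.2 (h.map ⟨_, continuous_mk_conf⟩)).symm
    exact this.trans (congrArg Path.Homotopic.Quotient.mk (Path.map_trans p q continuous_mk_conf))
  rw [hr, ← Path.Homotopic.Quotient.trans_assoc,
    ← loopDiff_mul _ ((straightClass E' s' hs').trans (motionClass q))]
  refine mul_mem (hq _ _ _ _) ?_
  rw [loopDiff_trans]
  exact hp _ _ _ _

/-- In the convex ball the motion can be replaced by a segment. A labelling that sorts `E'` also
sorts `E`, hence the whole segment, so only two straight paths to `E` remain to be compared. -/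
theorem isTwistProduct_of_mem_ball {E E' : OrdConf N} {ε : ℝ}
    (hε : ∀ x ∈ Metric.ball E.1 ε, Function.Injective x ∧ ∀ s, SortsRe x s → SortsRe E.1 s)
    (p : Path E E') (hp : ∀ t, (p t).1 ∈ Metric.ball E.1 ε) : IsTwistProduct p := by
  have hE : E.1 ∈ Metric.ball E.1 ε := by simpa using hp 0
  have hE' : E'.1 ∈ Metric.ball E.1 ε := by simpa using hp 1
  have hball : ContractibleSpace (Metric.ball E.1 ε) :=
    (convex_ball E.1 ε).contractibleSpace ⟨_, hE⟩
  have hseg : ∀ t : I, (1 - t : ℝ) • E.1 + (t : ℝ) • E'.1 ∈ Metric.ball E.1 ε := fun t =>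
    convex_ball E.1 ε hE hE' (sub_nonneg.2 t.2.2) t.2.1 (by ring)
  let l : Path (⟨E.1, hE⟩ : Metric.ball E.1 ε) ⟨E'.1, hE'⟩ :=
    { toFun := fun t => ⟨_, hseg t⟩
      continuous_toFun := Continuous.subtype_mk (by fun_prop) _
      source' := by simp
      target' := by simp }
  let pb : Path (⟨E.1, hE⟩ : Metric.ball E.1 ε) ⟨E'.1, hE'⟩ :=
    { toFun := fun t => ⟨_, hp t⟩
      continuous_toFun := Continuous.subtype_mk (by fun_prop) _
      source' := by simp
      target' := by simp }
  have hf : Continuous fun x : Metric.ball E.1 ε => (⟨x.1, (hε x.1 x.2).1⟩ : OrdConf N) :=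
    continuous_subtype_val.subtype_mk _
  let q : Path E E' := l.map hf
  have hq : p.Homotopic q :=
    Path.Homotopic.of_simplyConnected hf pb l (fun _ => rfl) (fun _ => rfl)
  have hpq : motionClass p = motionClass q :=
    Path.Homotopic.Quotient.eq.2 (hq.map ⟨_, continuous_mk_conf⟩)
  intro s s' hs hs'
  have hs'' := (hε _ hE').2 s' hs'
  have hsort : ∀ t, SortsRe (q t).1 s' := by
    intro t i j hij
    have h1 := hs'' hij
    have h2 := hs' hij
    have e : ∀ j, ((q t).1 j).re = (1 - t) * (E.1 j).re + t * (E'.1 j).re := by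
      intro j
      have : (q t).1 j = ((1 - t : ℝ) • E.1 + (t : ℝ) • E'.1) j := rfl
      rw [this, Pi.add_apply, Pi.smul_apply, Pi.smul_apply, Complex.add_re, Complex.smul_re,
        Complex.smul_re, smul_eq_mul, smul_eq_mul]
    simp only [e]
    exact add_le_add (mul_le_mul_of_nonneg_left h1 (sub_nonneg.2 t.2.2))
      (mul_le_mul_of_nonneg_left h2 t.2.1)
  rw [hpq, ← straightClass_trans q s' hsort hs'' hs']
  exact (loopDiff_trans _ _ (motionClass q)).symm ▸ loopDiff_straightClass_mem _ _ _ _ _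

/-- Every motion of labelled points is a product of half twists, if the ends are joined to the
base configuration by straight paths. -/
theorem isTwistProduct {E E' : OrdConf N} (p : Path E E') : IsTwistProduct p := by
  have key : IsTwistProduct (p.subpath 0 1) := by
    -- On the connected interval a transitive relation that holds in both directions between nearby
    -- times holds between all times.
    refine PreconnectedSpace.induction₂' (fun t t' => IsTwistProduct (p.subpath t t')) ?_ ?_ 0 1
    · intro t
      obtain ⟨ε, hε, hball⟩ := exists_ball_sortsRe (p t)
      have hc : ContinuousAt (fun t' => (p t').1) t :=
        (continuous_subtype_val.comp p.continuous).continuousAt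
      obtain ⟨δ, hδ, hδ'⟩ := Metric.continuousAt_iff.1 hc ε hε
      filter_upwards [Metric.ball_mem_nhds t hδ] with t' ht'
      have h : IsTwistProduct (p.subpath t t') := by
        refine isTwistProduct_of_mem_ball hball _ fun v => hδ' ?_
        have h1 : dist (t' : ℝ) t < δ := ht'
        show |((1 - v : ℝ) * t + v * t') - t| < δ
        rw [Real.dist_eq] at h1
        have : ((1 - v : ℝ) * t + v * t') - t = v * (t' - t) := by ring
        rw [this, abs_mul, abs_of_nonneg v.2.1]
        exact lt_of_le_of_lt (mul_le_of_le_one_left (abs_nonneg _) v.2.2) h1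
      exact ⟨h, by simpa using h.symm⟩
    · refine ⟨fun a b c hab hbc => ?_⟩
      exact hab.of_homotopic hbc ⟨Path.Homotopy.subpathTransSubpath p a b c⟩
  rw [Path.subpath_zero_one] at key
  have h : ∀ (x y : OrdConf N) (hx : x = E) (hy : y = E'), IsTwistProduct (p.cast hx hy) →
      IsTwistProduct p := by
    rintro x y rfl rfl h
    exact h
  exact h _ _ _ _ key

/-! ### From labelled motions to loops of unlabelled points -/

/-- Relabelling of configurations. -/
instance : MulAction (Equiv.Perm (Fin N)) (OrdConf N) where
  smul s E := ⟨E.1 ∘ (s⁻¹ : Equiv.Perm (Fin N)), E.2.comp (s⁻¹ : Equiv.Perm (Fin N)).injective⟩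
  one_smul _ := rfl
  mul_smul s s' E := Subtype.ext (by
    show E.1 ∘ ((s * s')⁻¹ : Equiv.Perm (Fin N)) = _
    rw [mul_inv_rev]
    rfl)

theorem smul_conf_val (s : Equiv.Perm (Fin N)) (E : OrdConf N) (j : Fin N) :
    (s • E).1 j = E.1 (s⁻¹ j) := rfl

/-- A finite group acts freely on a locally compact space, since the labelled configurations are
open in ℂ^N. -/
theorem isCoveringMap_mk_conf : IsCoveringMap fun E : OrdConf N => (⟦E⟧ : UConf N) := by
  have hc : ContinuousConstSMul (Equiv.Perm (Fin N)) (OrdConf N) :=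
    ⟨fun s => continuous_induced_rng.2 (continuous_pi fun j =>
      (continuous_apply (s⁻¹ j)).comp continuous_subtype_val)⟩
  have hd : ProperlyDiscontinuousSMul (Equiv.Perm (Fin N)) (OrdConf N) :=
    ⟨fun _ _ => Set.toFinite _⟩
  have hcan : IsCancelSMul (Equiv.Perm (Fin N)) (OrdConf N) := by
    refine ⟨fun s s' E h => inv_injective (Equiv.ext fun j => E.2 ?_)⟩
    exact congrFun (congrArg Subtype.val h) j
  have ho : IsOpen {E : Fin N → ℂ | Function.Injective E} := by
    refine isOpen_iff_mem_nhds.2 fun E hE => ?_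
    obtain ⟨ε, hε, h⟩ := exists_ball_sortsRe ⟨E, hE⟩
    exact Filter.mem_of_superset (Metric.ball_mem_nhds E hε) fun x hx => (h x hx).1
  have hl : LocallyCompactSpace (OrdConf N) := ho.locallyCompactSpace
  have hq : Topology.IsQuotientMap fun E : OrdConf N => (⟦E⟧ : UConf N) :=
    isQuotientMap_quotient_mk'
  refine (hq.isQuotientCoveringMap_of_properlyDiscontinuousSMul
    (G := Equiv.Perm (Fin N)) ?_).isCoveringMap
  intro E E'
  rw [MulAction.mem_orbit_iff]
  constructor
  · intro h
    obtain ⟨s, hs⟩ := Quotient.exact h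
    exact ⟨s, Subtype.ext (funext fun j => by rw [smul_conf_val, hs]; simp)⟩
  · rintro ⟨s, rfl⟩
    exact Quotient.sound ⟨s, fun j => by rw [smul_conf_val]; simp⟩

theorem sortsRe_baseTuple : SortsRe (baseTuple N).1 1 := strictMono_baseTuple.monotone

/-- The braid group is generated by the half twists. -/
theorem halfTwistSubgroup_eq_top : halfTwistSubgroup N = ⊤ := by
  rw [eq_top_iff]
  intro β _
  induction β using Path.Homotopic.Quotient.ind with | mk γ
  obtain ⟨Γ, hΓ, hΓ0⟩ := isCoveringMap_mk_conf.exists_path_lifts γ.toContinuousMap (baseTuple N)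
    γ.source
  have hΓ1 : baseConf N = ⟦Γ 1⟧ := γ.target.symm.trans (congrFun hΓ 1).symm
  obtain ⟨s, hs⟩ := Quotient.exact hΓ1
  have hs' : SortsRe (Γ 1).1 s⁻¹ := by
    intro i j hij
    simp only [hs]
    simpa using strictMono_baseTuple.monotone hij
  let p : Path (baseTuple N) (Γ 1) := ⟨Γ, hΓ0, rfl⟩
  have h := isTwistProduct p 1 s⁻¹ sortsRe_baseTuple hs'
  have h0 : straightClass (baseTuple N) 1 sortsRe_baseTuple = Path.Homotopic.Quotient.refl _ := by
    refine congrArg Path.Homotopic.Quotient.mk (Path.ext (funext fun t => ?_))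
    refine congrArg _ (Subtype.ext (funext fun j => ?_))
    simp only [straightTuple, Equiv.Perm.coe_one, id]
    ring
  -- The lift ends at a relabelling of the base tuple; once this is undone, the straight path does
  -- not move.
  have h1 : ∀ t, straightPath (Γ 1) s⁻¹ hs' t = baseConf N := fun t => by
    refine congrArg _ (Subtype.ext (funext fun j => ?_))
    have : s (s⁻¹ j) = j := s.apply_symm_apply j
    simp only [straightTuple, hs, this]
    ring
  have h3 : (straightClass (baseTuple N) 1 sortsRe_baseTuple).trans (motionClass p) =
      motionClass p :=
    (congrArg (fun q => Path.Homotopic.Quotient.trans q (motionClass p)) h0).trans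
      (Path.Homotopic.Quotient.refl_trans (motionClass p))
  rw [h3] at h
  -- The end `⟦Γ 1⟧` is equal to the base configuration, but not by definition, so the end is
  -- generalized before substitution.
  have h2 : ∀ (c : UConf N) (hc : baseConf N = c) (q r : Path (baseConf N) c),
      (∀ t, q t = γ t) → (∀ t, r t = baseConf N) →
      loopDiff (Path.Homotopic.Quotient.mk q) (Path.Homotopic.Quotient.mk r) =
        Path.Homotopic.Quotient.mk γ := by
    rintro c rfl q r hq hr
    obtain rfl : q = γ := Path.ext (funext hq)
    obtain rfl : r = Path.refl _ := Path.ext (funext hr)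
    exact Path.Homotopic.Quotient.trans_refl _
  exact by
    rw [← h2 _ hΓ1 (p.map continuous_mk_conf) (straightPath (Γ 1) s⁻¹ hs')
      (fun t => congrFun hΓ t) h1]
    exact h

end Generation

/-! ### The variation of the argument along paths -/

section Argument

theorem argVariation_congr {z z' : I → ℂ} (h : z = z') (hc : Continuous z) (h0 : ∀ t, z t ≠ 0)
    (hc' : Continuous z') (h0' : ∀ t, z' t ≠ 0) : argVariation hc h0 = argVariation hc' h0' := by
  subst h
  rfl

/-- The variation of the argument is the increment of the imaginary part of a continuous
logarithm. -/
theorem argVariation_of_exp {z : I → ℂ} (hc : Continuous z) (h0 : ∀ t, z t ≠ 0) {L : I → ℂ}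
    (hL : Continuous L) (h : ∀ t, Complex.exp (L t) = z t) :
    argVariation hc h0 = (L 1).im - (L 0).im := by
  refine argVariation_eq hc h0 (Complex.continuous_im.comp hL) fun t => ?_
  rw [← h t, Complex.norm_exp, Complex.ofReal_exp, ← Complex.exp_add]
  exact congrArg _ (Complex.re_add_im _).symm

variable {X : Type*} [TopologicalSpace X] {f : X → ℂ} (hf : Continuous f) (h0 : ∀ x, f x ≠ 0)
  {x y z : X}

/-- The variation of the argument of a nowhere vanishing function along a path. -/
noncomputable def pathArg (γ : Path x y) : ℝ :=
  argVariation (z := fun t => f (γ t)) (hf.comp γ.continuous) fun t => h0 (γ t)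

include hf h0 in
theorem exists_log_along (γ : Path x y) {w : ℂ} (hw : Complex.exp w = f x) :
    ∃ L : C(I, ℂ), (∀ t, Complex.exp (L t) = f (γ t)) ∧ L 0 = w := by
  obtain ⟨L, hL, hL0⟩ := Complex.isCoveringMap_exp.exists_path_lifts
    ⟨fun t => (⟨f (γ t), h0 _⟩ : {z : ℂ // z ≠ 0}), (hf.comp γ.continuous).subtype_mk _⟩ w
    (Subtype.ext (by simpa using hw.symm))
  exact ⟨L, fun t => congrArg Subtype.val (congrFun hL t), hL0⟩

theorem pathArg_of_exp (γ : Path x y) {L : C(I, ℂ)} (h : ∀ t, Complex.exp (L t) = f (γ t)) :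
    pathArg hf h0 γ = (L 1).im - (L 0).im :=
  argVariation_of_exp _ _ L.continuous h

/-- Lifts through the covering `exp` of homotopic paths, with a common start, have a common end. -/
theorem pathArg_eq_of_homotopic {γ γ' : Path x y} (h : γ.Homotopic γ') :
    pathArg hf h0 γ = pathArg hf h0 γ' := by
  let g : C(X, {z : ℂ // z ≠ 0}) := ⟨fun x => ⟨f x, h0 x⟩, hf.subtype_mk _⟩
  have hw : g x = ⟨Complex.exp (Complex.log (f x)), Complex.exp_ne_zero _⟩ :=
    Subtype.ext (Complex.exp_log (h0 x)).symm
  have key := Complex.isCoveringMap_exp.liftPath_apply_one_eq_of_homotopicRel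
    (γ₀ := (γ.map g.continuous).toContinuousMap) (γ₁ := (γ'.map g.continuous).toContinuousMap)
    (h.map g) (Complex.log (f x)) ((γ.map g.continuous).source.trans hw)
    ((γ'.map g.continuous).source.trans hw)
  have hl := fun (δ : Path x y) (t : I) => congrArg Subtype.val (congrFun
    (Complex.isCoveringMap_exp.liftPath_lifts (δ.map g.continuous).toContinuousMap
      (Complex.log (f x)) ((δ.map g.continuous).source.trans hw)) t)
  rw [pathArg_of_exp hf h0 γ (hl γ), pathArg_of_exp hf h0 γ' (hl γ'), key,
    Complex.isCoveringMap_exp.liftPath_zero, Complex.isCoveringMap_exp.liftPath_zero]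

theorem pathArg_trans (γ : Path x y) (γ' : Path y z) :
    pathArg hf h0 (γ.trans γ') = pathArg hf h0 γ + pathArg hf h0 γ' := by
  obtain ⟨L, hL, hL0⟩ := exists_log_along hf h0 γ (Complex.exp_log (h0 x))
  -- The second logarithm starts where the first ends, so that they concatenate.
  obtain ⟨L', hL', hL0'⟩ := exists_log_along hf h0 γ' (w := L 1) (by rw [hL, γ.target])
  let P : Path (L 0) (L 1) := ⟨L, rfl, rfl⟩
  let P' : Path (L 1) (L' 1) := ⟨L', hL0', rfl⟩
  have h : ∀ t, Complex.exp ((P.trans P').toContinuousMap t) = f (γ.trans γ' t) := by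
    intro t
    show Complex.exp (P.trans P' t) = _
    rw [Path.trans_apply, Path.trans_apply]
    split_ifs
    · exact hL _
    · exact hL' _
  rw [pathArg_of_exp hf h0 _ h, pathArg_of_exp hf h0 _ hL, pathArg_of_exp hf h0 _ hL', hL0']
  have e1 : (P.trans P').toContinuousMap 1 = L' 1 := (P.trans P').target
  have e0 : (P.trans P').toContinuousMap 0 = L 0 := (P.trans P').source
  rw [e1, e0]
  ring

theorem pathArg_refl : pathArg hf h0 (Path.refl x) = 0 := by
  have := pathArg_of_exp hf h0 (Path.refl x) (L := ContinuousMap.const I (Complex.log (f x)))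
    fun t => Complex.exp_log (h0 x)
  simpa using this

theorem pathArg_symm (γ : Path x y) : pathArg hf h0 γ.symm = -pathArg hf h0 γ := by
  have h := pathArg_eq_of_homotopic hf h0 (Path.Homotopic.trans_symm γ)
  rw [pathArg_trans, pathArg_refl] at h
  linarith

theorem exists_int_pathArg (γ : Path x x) : ∃ n : ℤ, (n : ℝ) = pathArg hf h0 γ / (2 * Real.pi) := by
  obtain ⟨L, hL, -⟩ := exists_log_along hf h0 γ (Complex.exp_log (h0 x))
  have h : Complex.exp (L 1) = Complex.exp (L 0) := by
    rw [hL, hL, γ.target, γ.source]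
  obtain ⟨n, hn⟩ := Complex.exp_eq_exp_iff_exists_int.1 h
  refine ⟨n, ?_⟩
  have hpi := Real.pi_pos
  rw [pathArg_of_exp hf h0 _ hL, hn]
  simp

/-- The winding number around zero of a nowhere vanishing function along a loop. -/
noncomputable def pathWinding (γ : Path x x) : ℤ := (exists_int_pathArg hf h0 γ).choose

theorem pathWinding_spec (γ : Path x x) :
    (pathWinding hf h0 γ : ℝ) = pathArg hf h0 γ / (2 * Real.pi) :=
  (exists_int_pathArg hf h0 γ).choose_spec

/-- The winding number around zero of a nowhere vanishing function, as a homomorphism on the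
fundamental group. -/
noncomputable def windingHom (x : X) : FundamentalGroup X x →* Multiplicative ℤ :=
  MonoidHom.mk'
    (fun β => Multiplicative.ofAdd (Quotient.lift (s := Path.Homotopic.setoid x x)
      (fun γ : Path x x => pathWinding hf h0 γ) (fun γ γ' h => by
        have h1 := pathWinding_spec hf h0 γ
        rw [pathArg_eq_of_homotopic hf h0 h, ← pathWinding_spec] at h1
        exact_mod_cast h1) β))
    (by
      intro β β'
      induction β using Path.Homotopic.Quotient.ind with | mk γ
      induction β' using Path.Homotopic.Quotient.ind with | mk γ'
      refine congrArg Multiplicative.ofAdd ?_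
      show pathWinding hf h0 (γ'.trans γ) = pathWinding hf h0 γ + pathWinding hf h0 γ'
      have h3 := pathWinding_spec hf h0 (γ'.trans γ)
      rw [pathArg_trans, add_div, ← pathWinding_spec, ← pathWinding_spec, add_comm] at h3
      exact_mod_cast h3)

theorem windingHom_mk (γ : Path x x) :
    ((windingHom hf h0 x (FundamentalGroup.fromPath (Path.Homotopic.Quotient.mk γ))).toAdd : ℝ) =
      pathArg hf h0 γ / (2 * Real.pi) :=
  pathWinding_spec hf h0 γ

end Argument

/-! ### The discriminant of a configuration -/

section Discriminant

variable {N : ℕ}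

theorem charpoly_diagonal_comp (E : Fin N → ℂ) (s : Equiv.Perm (Fin N)) :
    (Matrix.diagonal fun j => E (s j)).charpoly = (Matrix.diagonal E).charpoly := by
  rw [Matrix.charpoly_diagonal, Matrix.charpoly_diagonal]
  exact Equiv.prod_comp s fun i => Polynomial.X - Polynomial.C (E i)

/-- The discriminant of the monic polynomial whose roots are the points of the configuration. -/
noncomputable def confDiscr (c : UConf N) : ℂ :=
  Quotient.lift (fun E : OrdConf N => (Matrix.diagonal E.1).charpoly.discr) (by
    rintro E E' ⟨s, hs⟩
    rw [← charpoly_diagonal_comp E.1 s, ← funext hs]) c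

theorem continuous_confDiscr : Continuous (confDiscr (N := N)) :=
  Continuous.quotient_lift
    ((continuous_charpoly_discr N).comp (continuous_subtype_val.matrix_diagonal)) _

theorem confDiscr_ne_zero (c : UConf N) : confDiscr c ≠ 0 := by
  induction c using Quotient.inductionOn with
  | h E =>
    refine charpoly_discr_ne_zero ?_
    rw [roots_charpoly_diagonal]
    exact Finset.univ.nodup.map E.2

theorem charpoly_diagonal_eigenvalueTuple (A : Matrix (Fin N) (Fin N) ℂ) :
    (Matrix.diagonal (eigenvalueTuple A)).charpoly = A.charpoly := by
  have hs := IsAlgClosed.splits (Matrix.diagonal (eigenvalueTuple A)).charpoly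
  rw [hs.eq_prod_roots_of_monic (Matrix.charpoly_monic _), roots_charpoly_diagonal,
    eigenvalueTuple_spec,
    ← (IsAlgClosed.splits A.charpoly).eq_prod_roots_of_monic A.charpoly_monic]

theorem confDiscr_eigenvalueConf (A : Matrix (Fin N) (Fin N) ℂ) (h : A.charpoly.roots.Nodup) :
    confDiscr (eigenvalueConf A h) = A.charpoly.discr :=
  congrArg Polynomial.discr (charpoly_diagonal_eigenvalueTuple A)

/-- The discriminant is, up to sign, the product of the differences of the roots. -/
theorem discr_charpoly_diagonal (E : Fin N → ℂ) :
    (Matrix.diagonal E).charpoly.discr =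
      (-1) ^ (N * (N - 1) / 2) * ∏ i, ∏ j ∈ Finset.univ.erase i, (E i - E j) := by
  set p := (Matrix.diagonal E).charpoly with hp
  have hd : p.natDegree = N := by simp [hp]
  have hm : p.Monic := Matrix.charpoly_monic _
  rcases Nat.eq_zero_or_pos N with rfl | hN
  · rw [hm.natDegree_eq_zero.1 hd, ← Polynomial.C_1, Polynomial.discr_C]
    simp
  · have h1 := Polynomial.resultant_deriv (f := p)
      (Polynomial.natDegree_pos_iff_degree_pos.1 (by omega))
    -- The resultant of the monic `p` with its derivative is the product of the derivative's values
    -- at the roots.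
    rw [Polynomial.resultant_eq_prod_eval _ _ _ (Polynomial.natDegree_derivative_le p)
      (IsAlgClosed.splits _), hm.leadingCoeff, one_pow, one_mul, mul_one, hd, hp,
      roots_charpoly_diagonal, Multiset.map_map, ← hp] at h1
    have h2 : ∀ i, p.derivative.eval (E i) = ∏ j ∈ Finset.univ.erase i, (E i - E j) := by
      intro i
      have h3 : p = Lagrange.nodal Finset.univ E := by
        rw [hp, Matrix.charpoly_diagonal, Lagrange.nodal]
      rw [h3, Lagrange.eval_nodal_derivative_eval_node_eq (Finset.mem_univ i), Lagrange.eval_nodal]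
    have h4 : (Finset.univ.val.map fun i => p.derivative.eval (E i)).prod =
        ∏ i, ∏ j ∈ Finset.univ.erase i, (E i - E j) := by
      simp only [h2]
      rfl
    rw [← h4]
    refine Eq.trans ?_ (congrArg (fun x => (-1) ^ (N * (N - 1) / 2) * x) h1).symm
    rw [← mul_assoc, ← pow_add, ← two_mul, pow_mul]
    simp

/-- The differences of the points along a half twist have continuous logarithms; only the
difference of the two exchanged points turns. -/
theorem exists_log_halfTwistFun_sub (k : Fin (N - 1)) {a b : Fin N} (ha : (a : ℕ) = k)
    (hb : (b : ℕ) = k + 1) (i j : Fin N) : ∃ L : I → ℂ, Continuous L ∧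
      (i ≠ j → ∀ t : I, Complex.exp (L t) = halfTwistFun k t i - halfTwistFun k t j) ∧
      (L 1).im - (L 0).im =
        (if i = a ∧ j = b then Real.pi else 0) + (if i = b ∧ j = a then Real.pi else 0) := by
  have hab : a ≠ b := fun h => by
    rw [h] at ha
    omega
  by_cases h1 : i = a ∧ j = b
  · obtain ⟨rfl, rfl⟩ := h1
    refine ⟨fun t => Real.pi * t * Complex.I + Real.pi * Complex.I, by fun_prop, fun _ t => ?_, ?_⟩
    · rw [Complex.exp_add, Complex.exp_pi_mul_I]
      simp only [halfTwistFun, ha, hb, if_true]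
      simp
      ring
    · simp [hab]
  by_cases h2 : i = b ∧ j = a
  · obtain ⟨rfl, rfl⟩ := h2
    refine ⟨fun t => Real.pi * t * Complex.I, by fun_prop, fun _ t => ?_, ?_⟩
    · simp only [halfTwistFun, ha, hb, if_true]
      simp
    · simp [hab.symm]
  rw [if_neg h1, if_neg h2, add_zero]
  by_cases hij : i = j
  · exact ⟨fun _ => 0, continuous_const, fun h => absurd hij h, by simp⟩
  have hcont : ∀ i : Fin N, Continuous fun t : I => halfTwistFun k (t : ℝ) i := by
    intro i
    unfold halfTwistFun
    split_ifs <;> fun_prop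
  -- At both ends all points are real, so the argument computed below is 0 there.
  have him : ∀ i : Fin N, (halfTwistFun k ((1 : I) : ℝ) i).im = 0 ∧
      (halfTwistFun k ((0 : I) : ℝ) i).im = 0 := by
    intro i
    unfold halfTwistFun
    split_ifs <;> simp [Complex.exp_pi_mul_I]
  -- A sign `c` moves the difference into the right half plane, where the principal logarithm is
  -- continuous.
  have hre : ∃ c : ℝ, c ≠ 0 ∧ ∀ t : I,
      0 < (c * (halfTwistFun k (t : ℝ) i - halfTwistFun k (t : ℝ) j)).re := by
    rcases lt_or_gt_of_ne hij with h | h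
    · refine ⟨-1, by norm_num, fun t => ?_⟩
      have := halfTwistFun_re_lt k t h fun hc =>
        h1 ⟨Fin.ext (hc.1.trans ha.symm), Fin.ext (hc.2.trans hb.symm)⟩
      rw [Complex.re_ofReal_mul, Complex.sub_re]
      linarith
    · refine ⟨1, by norm_num, fun t => ?_⟩
      have := halfTwistFun_re_lt k t h fun hc =>
        h2 ⟨Fin.ext (hc.2.trans hb.symm), Fin.ext (hc.1.trans ha.symm)⟩
      rw [Complex.re_ofReal_mul, Complex.sub_re]
      linarith
  obtain ⟨c, hc, hpos⟩ := hre
  refine ⟨fun t => Complex.log (c * (halfTwistFun k (t : ℝ) i - halfTwistFun k (t : ℝ) j)) -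
    Complex.log c, ?_, fun _ t => ?_, ?_⟩
  · refine Continuous.sub (Continuous.clog ?_ fun t => Or.inl (hpos t)) continuous_const
    exact continuous_const.mul ((hcont i).sub (hcont j))
  · have h3 : (c : ℂ) ≠ 0 := by exact_mod_cast hc
    have h4 : (c * (halfTwistFun k (t : ℝ) i - halfTwistFun k (t : ℝ) j) : ℂ) ≠ 0 := by
      intro h
      have := hpos t
      rw [h] at this
      simp at this
    rw [Complex.exp_sub, Complex.exp_log h4, Complex.exp_log h3, mul_div_cancel_left₀ _ h3]
  · have harg : ∀ t : I, (halfTwistFun k (t : ℝ) i).im = 0 → (halfTwistFun k (t : ℝ) j).im = 0 →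
        (Complex.log (c * (halfTwistFun k (t : ℝ) i - halfTwistFun k (t : ℝ) j))).im = 0 := by
      intro t hi hj
      rw [Complex.log_im, Complex.arg_eq_zero_iff]
      exact ⟨(hpos t).le, by rw [Complex.im_ofReal_mul, Complex.sub_im, hi, hj]; simp⟩
    rw [Complex.sub_im, Complex.sub_im, harg 1 (him i).1 (him j).1, harg 0 (him i).2 (him j).2]
    ring

/-- Along a half twist the discriminant turns once around zero. -/
theorem pathArg_halfTwist (k : Fin (N - 1)) :
    pathArg continuous_confDiscr confDiscr_ne_zero (halfTwist k) = 2 * Real.pi := by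
  have hk := k.2
  obtain ⟨a, ha⟩ : ∃ a : Fin N, (a : ℕ) = k := ⟨⟨k, by omega⟩, rfl⟩
  obtain ⟨b, hb⟩ : ∃ b : Fin N, (b : ℕ) = k + 1 := ⟨⟨k + 1, by omega⟩, rfl⟩
  have hab : a ≠ b := fun h => by
    rw [h] at ha
    omega
  choose L hLc hL hLim using exists_log_halfTwistFun_sub k ha hb
  have hsign : ((-1) ^ (N * (N - 1) / 2) : ℂ) ≠ 0 := pow_ne_zero _ (by norm_num)
  let M : C(I, ℂ) := ⟨fun t => Complex.log ((-1) ^ (N * (N - 1) / 2)) +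
    ∑ i, ∑ j ∈ Finset.univ.erase i, L i j t,
    continuous_const.add (continuous_finsetSum _ fun i _ => continuous_finsetSum _ fun j _ =>
      hLc i j)⟩
  have hM : ∀ t, Complex.exp (M t) = confDiscr (halfTwist k t) := by
    intro t
    refine Eq.trans ?_ (discr_charpoly_diagonal (halfTwistFun k t)).symm
    show Complex.exp (_ + _) = _
    rw [Complex.exp_add, Complex.exp_log hsign, Complex.exp_sum]
    congr 1
    refine Finset.prod_congr rfl fun i _ => ?_
    rw [Complex.exp_sum]
    exact Finset.prod_congr rfl fun j hj => hL i j (Finset.ne_of_mem_erase hj).symm t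
  rw [pathArg_of_exp _ _ _ hM]
  have h1 : (M 1).im - (M 0).im = ∑ i, ∑ j ∈ Finset.univ.erase i, ((L i j 1).im - (L i j 0).im) := by
    show (_ + _ : ℂ).im - (_ + _ : ℂ).im = _
    simp only [Complex.add_im, Complex.im_sum, Finset.sum_sub_distrib]
    ring
  -- The ordered pairs (a, b) and (b, a) contribute π each; the formula for the increment is zero on
  -- the diagonal, so the erased term can be restored.
  have h2 : ∀ i, ∑ j ∈ Finset.univ.erase i, ((L i j 1).im - (L i j 0).im) =
      (if i = a then Real.pi else 0) + (if i = b then Real.pi else 0) := by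
    intro i
    simp only [hLim]
    rw [Finset.sum_erase _ (by
      rw [if_neg (fun h => hab (h.1.symm.trans h.2)), if_neg (fun h => hab (h.2.symm.trans h.1)),
        add_zero]), Finset.sum_add_distrib]
    congr 1
    · by_cases h : i = a <;> simp [h]
    · by_cases h : i = b <;> simp [h]
  rw [h1]
  simp only [h2]
  rw [Finset.sum_add_distrib, Finset.sum_ite_eq' Finset.univ a, Finset.sum_ite_eq' Finset.univ b]
  simp
  ring

end Discriminant

/-! ### The half twists in the abelianization -/

section Abelianization

variable {N : ℕ}

/-- The configuration `{0, i, 2 i, …}` on the imaginary axis, for which every order of the points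
is an order by increasing real part. -/
noncomputable def columnTuple (N : ℕ) : OrdConf N :=
  ⟨fun j => ((j : ℕ) : ℂ) * Complex.I, fun _ _ h =>
    Fin.ext (Nat.cast_injective (mul_right_cancel₀ Complex.I_ne_zero h))⟩

theorem sortsRe_columnTuple (s : Equiv.Perm (Fin N)) : SortsRe (columnTuple N).1 s :=
  fun i j _ => by simp [columnTuple]

theorem loopDiff_columnTuple (s : Equiv.Perm (Fin N)) (k : Fin (N - 1)) {a b : Fin N}
    (ha : (a : ℕ) = k) (hb : (b : ℕ) = k + 1) (h : s a < s b) :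
    loopDiff (straightClass _ s (sortsRe_columnTuple s))
      (straightClass _ (s * Equiv.swap a b) (sortsRe_columnTuple _)) = braidGen k :=
  loopDiff_straightClass_swap _ _ _ k ha hb (by simp [columnTuple])
    (by simpa [columnTuple] using h) _

/-- The braid relation. -/
theorem braidGen_braid_relation {k l : Fin (N - 1)} (h : (l : ℕ) = k + 1) :
    braidGen k * braidGen l * braidGen k = braidGen l * braidGen k * braidGen l := by
  have hk := k.2
  have hl := l.2
  obtain ⟨a, ha⟩ : ∃ a : Fin N, (a : ℕ) = k := ⟨⟨k, by omega⟩, rfl⟩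
  obtain ⟨b, hb⟩ : ∃ b : Fin N, (b : ℕ) = k + 1 := ⟨⟨k + 1, by omega⟩, rfl⟩
  obtain ⟨c, hc⟩ : ∃ c : Fin N, (c : ℕ) = k + 2 := ⟨⟨k + 2, by omega⟩, rfl⟩
  have hab : a < b := by rw [Fin.lt_def]; omega
  have hbc : b < c := by rw [Fin.lt_def]; omega
  have hac := hab.trans hbc
  have hlb : (b : ℕ) = l := hb.trans h.symm
  have hlc : (c : ℕ) = l + 1 := by rw [hc, h]
  let C := fun s => straightClass (columnTuple N) s (sortsRe_columnTuple s)
  have p1 := loopDiff_columnTuple 1 k ha hb hab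
  have p2 := loopDiff_columnTuple (1 * Equiv.swap a b) l hlb hlc
    (by simpa [Equiv.swap_apply_of_ne_of_ne hac.ne' hbc.ne'] using hac)
  have p3 := loopDiff_columnTuple (1 * Equiv.swap a b * Equiv.swap b c) k ha hb
    (by simpa [Equiv.swap_apply_of_ne_of_ne hab.ne hac.ne,
      Equiv.swap_apply_of_ne_of_ne hac.ne' hbc.ne'] using hbc)
  have q1 := loopDiff_columnTuple 1 l hlb hlc hbc
  have q2 := loopDiff_columnTuple (1 * Equiv.swap b c) k ha hb
    (by simpa [Equiv.swap_apply_of_ne_of_ne hab.ne hac.ne] using hac)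
  have q3 := loopDiff_columnTuple (1 * Equiv.swap b c * Equiv.swap a b) l hlb hlc
    (by simpa [Equiv.swap_apply_of_ne_of_ne hab.ne hac.ne,
      Equiv.swap_apply_of_ne_of_ne hac.ne' hbc.ne'] using hab)
  -- Both words spell the transposition of `a` and `c`. The two chains of straight paths thus have
  -- the same ends, and telescoping equates the products of twists.
  have hs : 1 * Equiv.swap a b * Equiv.swap b c * Equiv.swap a b =
      1 * Equiv.swap b c * Equiv.swap a b * Equiv.swap b c := by
    rw [one_mul, one_mul]
    ext j
    simp only [Equiv.Perm.coe_mul, Function.comp_apply, Equiv.swap_apply_def]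
    have := hab.ne
    have := hbc.ne
    have := hac.ne
    grind
  have p := loopDiff_mul (C 1) (C (1 * Equiv.swap a b * Equiv.swap b c))
    (C (1 * Equiv.swap a b * Equiv.swap b c * Equiv.swap a b))
  rw [p3, ← loopDiff_mul (C 1) (C (1 * Equiv.swap a b)), p1, p2, ← mul_assoc] at p
  have q := loopDiff_mul (C 1) (C (1 * Equiv.swap b c * Equiv.swap a b))
    (C (1 * Equiv.swap b c * Equiv.swap a b * Equiv.swap b c))
  rw [q3, ← loopDiff_mul (C 1) (C (1 * Equiv.swap b c)), q1, q2, ← mul_assoc] at q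
  rw [p, q, hs]

/-- In a commutative group the relation xyx = yxy gives x = y, so neighbouring generators agree. -/
theorem abelianization_braidGen_eq (k l : Fin (N - 1)) :
    Abelianization.of (braidGen k) = Abelianization.of (braidGen l) := by
  have h : ∀ m (hm : m < N - 1) (h0 : 0 < N - 1), Abelianization.of (braidGen (N := N) ⟨m, hm⟩) =
      Abelianization.of (braidGen ⟨0, h0⟩) := by
    intro m hm h0
    induction m with
    | zero => rfl
    | succ m ih =>
      rw [← ih (by omega)]
      have h1 := congrArg Abelianization.of
        (braidGen_braid_relation (N := N) (k := ⟨m, by omega⟩) (l := ⟨m + 1, hm⟩) rfl)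
      simp only [map_mul] at h1
      generalize Abelianization.of (braidGen (⟨m, by omega⟩ : Fin (N - 1))) = x at h1 ⊢
      generalize Abelianization.of (braidGen (⟨m + 1, hm⟩ : Fin (N - 1))) = y at h1 ⊢
      rw [mul_comm x y] at h1
      exact (mul_left_cancel h1).symm
  exact (h k k.2 k.pos).trans (h l l.2 k.pos).symm

theorem exists_word (β : BraidGroup N) : ∃ w : List (Fin (N - 1) × ℤ), β = braidOfWord w := by
  have hβ : β ∈ halfTwistSubgroup N := halfTwistSubgroup_eq_top ▸ Subgroup.mem_top β
  induction hβ using Subgroup.closure_induction with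
  | mem x hx =>
    obtain ⟨k, rfl⟩ := hx
    exact ⟨[(k, 1)], by simp [braidOfWord]⟩
  | one => exact ⟨[], by simp [braidOfWord]⟩
  | mul x y _ _ hx hy =>
    obtain ⟨w, rfl⟩ := hx
    obtain ⟨w', rfl⟩ := hy
    exact ⟨w ++ w', by simp [braidOfWord]⟩
  | inv x _ hx =>
    obtain ⟨w, rfl⟩ := hx
    refine ⟨(w.map fun p => (p.1, -p.2)).reverse, ?_⟩
    simp [braidOfWord, List.prod_inv_reverse, List.map_reverse, Function.comp_def]

theorem map_braidOfWord {F : BraidGroup N →* Multiplicative ℤ}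
    (hF : ∀ k, F (braidGen k) = Multiplicative.ofAdd 1) (w : List (Fin (N - 1) × ℤ)) :
    F (braidOfWord w) = Multiplicative.ofAdd (exponentSum w) := by
  induction w with
  | nil => exact map_one F
  | cons p w ih =>
    have h1 : braidOfWord (p :: w) = braidGen p.1 ^ p.2 * braidOfWord w := by simp [braidOfWord]
    have h2 : exponentSum (p :: w) = p.2 + exponentSum w := by simp [exponentSum]
    rw [h1, h2, map_mul, map_zpow, hF, ih, ofAdd_add, ← ofAdd_zsmul, smul_eq_mul, mul_one]

theorem ker_eq_commutator {F : BraidGroup N →* Multiplicative ℤ}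
    (hF : ∀ k, F (braidGen k) = Multiplicative.ofAdd 1) : F.ker = commutator (BraidGroup N) := by
  refine le_antisymm (fun β hβ => ?_) (Abelianization.commutator_subset_ker F)
  obtain ⟨g, hg⟩ : ∃ g, ∀ k : Fin (N - 1), Abelianization.of (braidGen k) = g := by
    -- For N ≤ 1 there are no generators, and any `g` serves.
    rcases isEmpty_or_nonempty (Fin (N - 1)) with h | ⟨⟨k⟩⟩
    · exact ⟨1, fun k => h.elim k⟩
    · exact ⟨_, fun l => abelianization_braidGen_eq l k⟩
  obtain ⟨w, rfl⟩ := exists_word β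
  have h1 : Abelianization.of (braidOfWord w) = g ^ exponentSum w := by
    clear hβ
    induction w with
    | nil => exact (map_one (Abelianization.of (G := BraidGroup N))).trans (zpow_zero g).symm
    | cons p w ih =>
      have h1 : braidOfWord (p :: w) = braidGen p.1 ^ p.2 * braidOfWord w := by simp [braidOfWord]
      have h2 : exponentSum (p :: w) = p.2 + exponentSum w := by simp [exponentSum]
      rw [h1, h2, map_mul, map_zpow, hg, ih, zpow_add]
  rw [MonoidHom.mem_ker, map_braidOfWord hF] at hβ
  have h2 : exponentSum w = 0 := hβ
  rw [h2, zpow_zero] at h1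
  rwa [← Abelianization.ker_of, MonoidHom.mem_ker]

end Abelianization

/-! ### Hamiltonians with prescribed eigenvalues -/

section Realization

variable {N : ℕ}

theorem isUnit_det_vandermonde (E : OrdConf N) : IsUnit (Matrix.vandermonde E.1).det :=
  isUnit_iff_ne_zero.2 (Matrix.det_vandermonde_ne_zero_iff.2 E.2)

/-- The matrix with eigenvalues `E` and the rows of the Vandermonde matrix as left
eigenvectors. -/
noncomputable def vandermondeConj (E : Fin N → ℂ) : Matrix (Fin N) (Fin N) ℂ :=
  (Matrix.vandermonde E)⁻¹ * Matrix.diagonal E * Matrix.vandermonde E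

/-- The permutation of the Vandermonde rows cancels that of the diagonal. A diagonal matrix alone
would depend on the labelling and would not descend to `UConf N`. -/
theorem vandermondeConj_comp (E : Fin N → ℂ) (s : Equiv.Perm (Fin N)) :
    vandermondeConj (E ∘ s) = vandermondeConj E := by
  have h1 : Matrix.vandermonde (E ∘ s) = (Matrix.vandermonde E).submatrix s (Equiv.refl _) := rfl
  have h2 : Matrix.diagonal (E ∘ s) = (Matrix.diagonal E).submatrix s s :=
    (Matrix.submatrix_diagonal_equiv E s).symm
  rw [vandermondeConj, h1, h2, Matrix.inv_submatrix_equiv, Matrix.submatrix_mul_equiv,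
    Matrix.submatrix_mul_equiv]
  rfl

theorem charpoly_vandermondeConj (E : OrdConf N) :
    (vandermondeConj E.1).charpoly = (Matrix.diagonal E.1).charpoly := by
  have h := Matrix.charpoly_units_conj'
    (Matrix.nonsingInvUnit _ (isUnit_det_vandermonde E)) (Matrix.diagonal E.1)
  rw [← h]
  rfl

/-- A continuous family of matrices in which the matrix at `c` has the spectrum `c`. -/
noncomputable def confMatrix (c : UConf N) : Matrix (Fin N) (Fin N) ℂ :=
  Quotient.lift (fun E : OrdConf N => vandermondeConj E.1) (by
    rintro E E' ⟨s, hs⟩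
    rw [← vandermondeConj_comp E.1 s, funext hs]
    rfl) c

theorem continuous_confMatrix : Continuous (confMatrix (N := N)) := by
  refine Continuous.quotient_lift ?_ _
  have hW : Continuous fun E : OrdConf N => Matrix.vandermonde E.1 := by
    refine continuous_matrix fun i j => ?_
    exact ((continuous_apply i).comp continuous_subtype_val).pow _
  have hW' : Continuous fun E : OrdConf N => (Matrix.vandermonde E.1)⁻¹ := by
    simp only [Matrix.inv_def, Ring.inverse_eq_inv']
    exact (hW.matrix_det.inv₀ fun E => (isUnit_det_vandermonde E).ne_zero).smul hW.matrix_adjugate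
  exact (hW'.mul continuous_subtype_val.matrix_diagonal).mul hW

theorem nodup_roots_confMatrix (c : UConf N) : (confMatrix c).charpoly.roots.Nodup := by
  induction c using Quotient.inductionOn with
  | h E =>
    show (vandermondeConj E.1).charpoly.roots.Nodup
    rw [charpoly_vandermondeConj, roots_charpoly_diagonal]
    exact Finset.univ.nodup.map E.2

theorem eigenvalueConf_confMatrix (c : UConf N) (h : (confMatrix c).charpoly.roots.Nodup) :
    eigenvalueConf (confMatrix c) h = c := by
  induction c using Quotient.inductionOn with
  | h E =>
    refine eigenvalueConf_eq_mk h E ?_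
    show _ = (vandermondeConj E.1).charpoly.roots
    rw [charpoly_vandermondeConj, roots_charpoly_diagonal]

/-- Every braid is an eigenvalue braid. -/
theorem exists_eigenvalueBraid_eq (β : BraidGroup N) : ∃ (K : Type u) (_ : TopologicalSpace K)
    (H : K → Matrix (Fin N) (Fin N) ℂ) (k₀ : K) (Γ : Path k₀ k₀)
    (hH : ContinuousOn H (Set.range Γ)) (hs : SeparableAlong H Γ)
    (α : Path (baseConf N) (eigenvalueConf (H k₀) hs.base)),
    eigenvalueBraid H Γ hH hs α = β := by
  induction β using Path.Homotopic.Quotient.ind with | mk γ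
  -- The configuration space is the parameter space and the given loop is Γ; `ULift` only adjusts
  -- the universe.
  have hs : SeparableAlong (fun c : ULift.{u} (UConf N) => confMatrix c.down)
    (γ.map continuous_uliftUp) := fun t => nodup_roots_confMatrix _
  have hb := eigenvalueConf_confMatrix (baseConf N) (nodup_roots_confMatrix _)
  refine ⟨ULift.{u} (UConf N), inferInstance, fun c => confMatrix c.down, ULift.up (baseConf N),
    γ.map continuous_uliftUp, (continuous_confMatrix.comp continuous_uliftDown).continuousOn, hs,
    (Path.refl (baseConf N)).cast rfl hb, ?_⟩
  have key : ∀ (c : UConf N) (hc : c = baseConf N) (α : Path (baseConf N) c) (δ : Path c c),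
      (∀ t, α t = baseConf N) → (∀ t, δ t = γ t) →
      Path.Homotopic.Quotient.mk ((α.trans δ).trans α.symm) = Path.Homotopic.Quotient.mk γ := by
    rintro c rfl α δ hα hδ
    obtain rfl : α = Path.refl _ := Path.ext (funext hα)
    obtain rfl : δ = γ := Path.ext (funext hδ)
    refine Path.Homotopic.Quotient.eq.2 ?_
    exact (Path.Homotopic.trans_refl _).trans (Path.Homotopic.refl_trans _)
  exact key _ hb _ _ (fun _ => rfl) fun t =>
    eigenvalueConf_confMatrix (γ t) (nodup_roots_confMatrix _)

end Realization

/-! ### The discriminant number -/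

section DiscriminantNumber

variable {N : ℕ} {K : Type*} [TopologicalSpace K]

/-- The winding number of the discriminant, as a homomorphism on the braid group. -/
noncomputable def discriminantHom (N : ℕ) : BraidGroup N →* Multiplicative ℤ :=
  windingHom continuous_confDiscr confDiscr_ne_zero (baseConf N)

theorem discriminantHom_braidGen (k : Fin (N - 1)) :
    discriminantHom N (braidGen k) = Multiplicative.ofAdd 1 := by
  have h := windingHom_mk continuous_confDiscr confDiscr_ne_zero (halfTwist k)
  rw [pathArg_halfTwist, div_self (by positivity)] at h
  refine Multiplicative.toAdd.injective ?_
  exact_mod_cast h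

theorem discriminantHom_eigenvalueBraid (H : K → Matrix (Fin N) (Fin N) ℂ) {k₀ : K}
    (Γ : Path k₀ k₀) (hH : ContinuousOn H (Set.range Γ)) (hs : SeparableAlong H Γ)
    (α : Path (baseConf N) (eigenvalueConf (H k₀) hs.base)) :
    ((discriminantHom N (eigenvalueBraid H Γ hH hs α)).toAdd : ℝ) =
      discriminantNumber H Γ hH hs := by
  have h1 : pathArg continuous_confDiscr confDiscr_ne_zero (eigenvalueLoop H Γ hH hs) =
      argVariation (z := discriminantAlong H Γ)
        ((continuous_charpoly_discr N).comp (continuous_along hH))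
        (fun t => charpoly_discr_ne_zero (hs t)) :=
    argVariation_congr (funext fun t => confDiscr_eigenvalueConf _ (hs t)) _ _ _ _
  have h2 := windingHom_mk continuous_confDiscr confDiscr_ne_zero
    ((α.trans (eigenvalueLoop H Γ hH hs)).trans α.symm)
  -- The contributions of `α` and its reverse cancel, which makes the choice of `α` irrelevant.
  rw [pathArg_trans, pathArg_trans, pathArg_symm, add_neg_cancel_comm, h1] at h2
  exact h2

end DiscriminantNumber

/-- Well-definedness is expressed by a single `F` that serves all Hamiltonians, loops and connecting
paths; since every braid is realized, it is determined by this property. -/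
theorem mainTheorem1 (N : ℕ) :
    (∀ (K : Type u) [TopologicalSpace K] (H : K → Matrix (Fin N) (Fin N) ℂ) (k₀ : K)
        (Γ : Path k₀ k₀) (hH : ContinuousOn H (Set.range Γ)) (hs : SeparableAlong H Γ)
        (α : Path (baseConf N) (eigenvalueConf (H k₀) hs.base)),
      (∃ w : List (Fin (N - 1) × ℤ), eigenvalueBraid H Γ hH hs α = braidOfWord w) ∧
      ∀ w : List (Fin (N - 1) × ℤ), eigenvalueBraid H Γ hH hs α = braidOfWord w →
        discriminantNumber H Γ hH hs = (exponentSum w : ℝ)) ∧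
    (∀ β : BraidGroup N, ∃ (K : Type u) (_ : TopologicalSpace K)
        (H : K → Matrix (Fin N) (Fin N) ℂ) (k₀ : K) (Γ : Path k₀ k₀)
        (hH : ContinuousOn H (Set.range Γ)) (hs : SeparableAlong H Γ)
        (α : Path (baseConf N) (eigenvalueConf (H k₀) hs.base)),
      eigenvalueBraid H Γ hH hs α = β) ∧
    ∃ F : BraidGroup N →* Multiplicative ℤ,
      (∀ (K : Type u) [TopologicalSpace K] (H : K → Matrix (Fin N) (Fin N) ℂ) (k₀ : K)
          (Γ : Path k₀ k₀) (hH : ContinuousOn H (Set.range Γ)) (hs : SeparableAlong H Γ)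
          (α : Path (baseConf N) (eigenvalueConf (H k₀) hs.base)),
        ((F (eigenvalueBraid H Γ hH hs α)).toAdd : ℝ) = discriminantNumber H Γ hH hs) ∧
      F.ker = commutator (BraidGroup N) ∧
      (2 ≤ N → Function.Surjective F) := by
  have hF := discriminantHom_braidGen (N := N)
  refine ⟨fun K _ H k₀ Γ hH hs α => ⟨exists_word _, fun w hw => ?_⟩,
    exists_eigenvalueBraid_eq, discriminantHom N,
    fun K _ H k₀ Γ hH hs α => discriminantHom_eigenvalueBraid H Γ hH hs α,
    ker_eq_commutator hF, fun h2 n => ?_⟩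
  · rw [← discriminantHom_eigenvalueBraid H Γ hH hs α, hw, map_braidOfWord hF]
    rfl
  · refine ⟨braidGen ⟨0, by omega⟩ ^ n.toAdd, ?_⟩
    rw [map_zpow, hF, ← ofAdd_zsmul, smul_eq_mul, mul_one]
    rfl
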